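/- Let $J_1,J_2,J_3$ be ferromagnetic couplings on the triangular lattice ($J_1,J_2,J_3>0$, $s=1$, reference coupling $J_{\rm ref}=J_1$), the square lattice ($J_1,J_2>0$, $J_3=0$, $s=1$, $J_{\rm ref}=J_1$; formulas of the triangular lattice) or the hexagonal lattice ($J_1,J_2,J_3>0$, $s=2$, $J_{\rm ref}=J_2$). For $\eta=J_{\rm ref}/k_BT>0$ put $\eta_i=(J_i/J_{\rm ref})\eta$, $t_i=\tanh\eta_i$, $r_{ij}=J_i/J_j$, and $$\alpha_0=1+t_1t_2t_3,\quad \alpha_1=t_1+t_2t_3,\quad \alpha_2=t_2+t_3t_1,\quad \alpha_3=t_3+t_1t_2,\quad R=2\cosh\eta_1\cosh\eta_2\cosh\eta_3$$ for the triangular and square lattices, $$\alpha_0=1,\quad \alpha_1=t_3t_1,\quad \alpha_2=t_2t_3,\quad \alpha_3=t_1t_2,\quad R=2(\cosh\eta_1\cosh\eta_2\cosh\eta_3)^{1/2}$$ for the hexagonal lattice. Let $A_0=\sum_{\mu=0}^{3}\alpha_\mu^2$, $A_1=2(\alpha_0\alpha_1-\alpha_2\alpha_3)$, $A_2=2(\alpha_0\alpha_2-\alpha_3\alpha_1)$,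 $A_3=2(\alpha_0\alpha_3-\alpha_1\alpha_2)$. For an integer $L\ge 1$ the free energy per site and per $k_BT$ of the infinitely long Ising cylinder of circumference $L$ is taken to be given by the closed expression $$f=-\ln R+\sum_{p} f_p,\qquad f_p=-\frac1{2sL}\int_0^{2\pi}\frac{d\phi}{2\pi}\ln\Bigl[A_0-A_1\cos\tfrac{2\pi p}{L}-A_2\cos\phi-A_3\cos\bigl(\tfrac{2\pi p}{L}-\phi\bigr)\Bigr],$$ where $p$ runs over $0,1,\dots,L-1$ for antiperiodically joined circumference (AJC) and over $\tfrac12,\tfrac32,\dots,L-\tfrac12$ for periodically joined circumference (PJC); $f$ below means the function so defined. Put $\epsilon=\partial f/\partial\eta$ and $c=-\eta^2\,\partial^2f/\partial\eta^2$, with the ratios $r_{ij}$ fixed. Then the equation $A_0-A_1-A_2-A_3=0$ has exactly one solution $\eta_c>0$ (the bulk critical point), with $T_c=J_{\rm ref}/(k_B\eta_c)$, and: 1. For AJC, $f$ is continuous on $(0,\infty)$, twice continuously differentiable on $(0,\infty)\setminus\{\eta_c\}$, and has unequal left and right derivatives at $\eta_c$ (a first-order transition). 2. For AJC, the one-sided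 limits of $\epsilon$ and $c$ at $T_c$ exist and are finite, and $$\lim_{T\to T_c^+}\epsilon-\lim_{T\to T_c^-}\epsilon=\Delta_\epsilon=\frac{a_\epsilon}{sL},\qquad \lim_{T\to T_c^+}c-\lim_{T\to T_c^-}c=\Delta_c=\frac{a_c}{sL},$$ where $a_\epsilon,a_c>0$ are, with all $t_i$ evaluated at $\eta_c$, $$a_\epsilon=2+r_{31}\frac{(1-t_3^2)(1+t_2^2)}{(t_3+t_2)(1-t_2t_3)}+r_{21}\frac{(1+t_3^2)(1-t_2^2)}{(t_3+t_2)(1-t_2t_3)},$$ $$\frac{a_c}{\eta_c^2}=(r_{31}-r_{21})^2\frac{(1-t_3^4)(1-t_2^4)}{(t_3+t_2)^2(1-t_2t_3)^2}+4r_{31}r_{21}\frac{(1-t_3^2)(1-t_2^2)}{(t_3+t_2)^2}$$ for the triangular and square lattices, and $$a_\epsilon=r_{12}\frac{(1+t_3^2)(1-t_1^2)}{(t_3+t_1)(1-t_1t_3)}+r_{32}\frac{(1-t_3^2)(1+t_1^2)}{(t_3+t_1)(1-t_1t_3)}+\frac{1-t_2^2}{t_2},$$ $$\frac{a_c}{\eta_c^2}=(r_{32}-r_{12})^2\frac{(1-t_3^4)(1-t_1^4)}{(t_3+t_1)^2(1-t_1t_3)^2}+4r_{32}r_{12}\frac{(1-t_3^2)(1-t_1^2)}{(t_3+t_1)^2}+\frac{1-t_2^4}{t_2^2}$$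 for the hexagonal lattice. 3. The jumps come only from the zero mode: $\ln R$ and all $f_p$ with $p=1,\dots,L-1$ are twice continuously differentiable on $(0,\infty)$, and with $$G(0,\eta)=\frac{[A_2^2+A_3^2+2A_2A_3]^{1/2}}{A_0-A_1},\quad D_\epsilon=\frac{1}{\sqrt{1-G(0,\eta)^2}}\frac{\partial}{\partial\eta}\ln G(0,\eta),\quad D_c=-\frac{\partial D_\epsilon}{\partial\eta},$$ one has $$\Delta_\epsilon=\frac1{2sL}\lim_{x\to0^+}\bigl[D_\epsilon(\eta_c-x)-D_\epsilon(\eta_c+x)\bigr],\qquad \Delta_c=\frac{\eta_c^2}{2sL}\lim_{x\to0^+}\bigl[D_c(\eta_c-x)-D_c(\eta_c+x)\bigr].$$ 4. For PJC, $f$ is twice continuously differentiable on $(0,\infty)$; neither $\epsilon$ nor $c$ jumps at $T_c$, and there is no first-order transition there. -/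

import Mathlib

open Filter Topology Set

noncomputable section

namespace IsingCylinder

/-- The planar lattices considered. -/
inductive Lattice where
  | triangular
  | square
  | hexagonal

/-- The two ways of joining the circumference: `σ_{m,L+1} = σ_{m,1}` (periodic) and
`σ_{m,L+1} = -σ_{m,1}` (antiperiodic). -/
inductive Joining where
  | periodic
  | antiperiodic

/-- The coupling constants along the three bond directions. -/
structure Couplings where
  J₁ : ℝ
  J₂ : ℝ
  J₃ : ℝ

/-- Ferromagnetic couplings. The square lattice is the triangular lattice without
the third bond. -/
def Couplings.Ferromagnetic (J : Couplings) : Lattice → Prop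
  | .triangular => 0 < J.J₁ ∧ 0 < J.J₂ ∧ 0 < J.J₃
  | .square => 0 < J.J₁ ∧ 0 < J.J₂ ∧ J.J₃ = 0
  | .hexagonal => 0 < J.J₁ ∧ 0 < J.J₂ ∧ 0 < J.J₃

/-- The coupling used as reference scale: `η = Jref / (k_B T)`. -/
def Jref : Lattice → Couplings → ℝ
  | .triangular, J => J.J₁
  | .square, J => J.J₁
  | .hexagonal, J => J.J₂

/-- Number of sites per unit cell. -/
def cellSites : Lattice → ℝ
  | .triangular => 1
  | .square => 1
  | .hexagonal => 2

section Weights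

variable (Λ : Lattice) (J : Couplings)

/-- `η_i = J_i / (k_B T) = (J_i / Jref) η`. -/
def η₁ (η : ℝ) : ℝ := J.J₁ / Jref Λ J * η
def η₂ (η : ℝ) : ℝ := J.J₂ / Jref Λ J * η
def η₃ (η : ℝ) : ℝ := J.J₃ / Jref Λ J * η

def t₁ (η : ℝ) : ℝ := Real.tanh (η₁ Λ J η)
def t₂ (η : ℝ) : ℝ := Real.tanh (η₂ Λ J η)
def t₃ (η : ℝ) : ℝ := Real.tanh (η₃ Λ J η)

def α₀ (η : ℝ) : ℝ :=
  match Λ with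
  | .hexagonal => 1
  | _ => 1 + t₁ Λ J η * t₂ Λ J η * t₃ Λ J η

def α₁ (η : ℝ) : ℝ :=
  match Λ with
  | .hexagonal => t₃ Λ J η * t₁ Λ J η
  | _ => t₁ Λ J η + t₂ Λ J η * t₃ Λ J η

def α₂ (η : ℝ) : ℝ :=
  match Λ with
  | .hexagonal => t₂ Λ J η * t₃ Λ J η
  | _ => t₂ Λ J η + t₃ Λ J η * t₁ Λ J η

def α₃ (η : ℝ) : ℝ :=
  match Λ with
  | .hexagonal => t₁ Λ J η * t₂ Λ J η
  | _ => t₃ Λ J η + t₁ Λ J η * t₂ Λ J η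

def A₀ (η : ℝ) : ℝ := α₀ Λ J η ^ 2 + α₁ Λ J η ^ 2 + α₂ Λ J η ^ 2 + α₃ Λ J η ^ 2
def A₁ (η : ℝ) : ℝ := 2 * (α₀ Λ J η * α₁ Λ J η - α₂ Λ J η * α₃ Λ J η)
def A₂ (η : ℝ) : ℝ := 2 * (α₀ Λ J η * α₂ Λ J η - α₃ Λ J η * α₁ Λ J η)
def A₃ (η : ℝ) : ℝ := 2 * (α₀ Λ J η * α₃ Λ J η - α₁ Λ J η * α₂ Λ J η)

/-- The regular prefactor of the partition function per site in the high-temperature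
normalisation: `2` for the spin and one factor `cosh η_i` for each bond, a site of the hexagonal
lattice owning half a bond of each kind. -/
def R (η : ℝ) : ℝ :=
  match Λ with
  | .hexagonal =>
      2 * √(Real.cosh (η₁ Λ J η) * Real.cosh (η₂ Λ J η) * Real.cosh (η₃ Λ J η))
  | _ => 2 * (Real.cosh (η₁ Λ J η) * Real.cosh (η₂ Λ J η) * Real.cosh (η₃ Λ J η))

/-- `η` is the bulk critical point of the Ising transition. -/
def IsCritical (η : ℝ) : Prop :=
  0 < η ∧ A₀ Λ J η - A₁ Λ J η - A₂ Λ J η - A₃ Λ J η = 0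

end Weights

/-- The offset of the momenta `p = pbar + Δ`. -/
def Joining.shift : Joining → ℝ
  | .periodic => 1 / 2
  | .antiperiodic => 0

section FreeEnergy

variable (Λ : Lattice) (J : Couplings) (L : ℕ)

/-- Contribution of the mode `p` to the free energy per site. -/
def modeFreeEnergy (p η : ℝ) : ℝ :=
  -(1 / (2 * cellSites Λ * L)) *
    ((∫ φ in (0 : ℝ)..(2 * Real.pi),
      Real.log (A₀ Λ J η - A₁ Λ J η * Real.cos (2 * Real.pi * p / L)
        - A₂ Λ J η * Real.cos φ - A₃ Λ J η * Real.cos (2 * Real.pi * p / L - φ)))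
      / (2 * Real.pi))

/-- Free energy per site and per `k_B T` of the infinitely long cylinder of circumference `L`. -/
def freeEnergy (b : Joining) (η : ℝ) : ℝ :=
  -Real.log (R Λ J η) + ∑ pbar ∈ Finset.range L, modeFreeEnergy Λ J L (pbar + b.shift) η

/-- Internal energy density in units of the reference coupling. -/
def internalEnergy (b : Joining) (η : ℝ) : ℝ := deriv (freeEnergy Λ J L b) η

def specificHeat (b : Joining) (η : ℝ) : ℝ := -η ^ 2 * deriv (internalEnergy Λ J L b) η

/-- The reduced inverse temperature `η` at temperature `T`; the same map sends `η_c` to `T_c`. -/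
def reduced (kB T : ℝ) : ℝ := Jref Λ J / (kB * T)

/-- The function `G(p, η)`. -/
def G (p η : ℝ) : ℝ :=
  √(A₂ Λ J η ^ 2 + A₃ Λ J η ^ 2 + 2 * A₂ Λ J η * A₃ Λ J η * Real.cos (2 * Real.pi * p / L)) /
    (A₀ Λ J η - A₁ Λ J η * Real.cos (2 * Real.pi * p / L))

def Dε (p η : ℝ) : ℝ :=
  1 / √(1 - G Λ J L p η ^ 2) * deriv (fun x => Real.log (G Λ J L p x)) η

def Dc (p η : ℝ) : ℝ := -deriv (Dε Λ J L p) η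

end FreeEnergy

section Amplitudes

variable (Λ : Lattice) (J : Couplings)

/-- Gap amplitude of the internal energy, evaluated at the critical point `ηc`. -/
def aε (ηc : ℝ) : ℝ :=
  let t1 := t₁ Λ J ηc
  let t2 := t₂ Λ J ηc
  let t3 := t₃ Λ J ηc
  match Λ with
  | .hexagonal =>
      J.J₁ / J.J₂ * ((1 + t3 ^ 2) * (1 - t1 ^ 2) / ((t3 + t1) * (1 - t1 * t3)))
        + J.J₃ / J.J₂ * ((1 - t3 ^ 2) * (1 + t1 ^ 2) / ((t3 + t1) * (1 - t1 * t3)))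
        + (1 - t2 ^ 2) / t2
  | _ =>
      2 + J.J₃ / J.J₁ * ((1 - t3 ^ 2) * (1 + t2 ^ 2) / ((t3 + t2) * (1 - t2 * t3)))
        + J.J₂ / J.J₁ * ((1 + t3 ^ 2) * (1 - t2 ^ 2) / ((t3 + t2) * (1 - t2 * t3)))

/-- Gap amplitude of the specific heat, evaluated at the critical point `ηc`. -/
def ac (ηc : ℝ) : ℝ :=
  let t1 := t₁ Λ J ηc
  let t2 := t₂ Λ J ηc
  let t3 := t₃ Λ J ηc
  match Λ with
  | .hexagonal =>
      ηc ^ 2 *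
        ((J.J₃ / J.J₂ - J.J₁ / J.J₂) ^ 2 *
            ((1 - t3 ^ 4) * (1 - t1 ^ 4) / ((t3 + t1) ^ 2 * (1 - t1 * t3) ^ 2))
          + 4 * (J.J₃ / J.J₂) * (J.J₁ / J.J₂) *
            ((1 - t3 ^ 2) * (1 - t1 ^ 2) / (t3 + t1) ^ 2)
          + (1 - t2 ^ 4) / t2 ^ 2)
  | _ =>
      ηc ^ 2 *
        ((J.J₃ / J.J₁ - J.J₂ / J.J₁) ^ 2 *
            ((1 - t3 ^ 4) * (1 - t2 ^ 4) / ((t3 + t2) ^ 2 * (1 - t2 * t3) ^ 2))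
          + 4 * (J.J₃ / J.J₁) * (J.J₂ / J.J₁) *
            ((1 - t3 ^ 2) * (1 - t2 ^ 2) / (t3 + t2) ^ 2))

end Amplitudes

/-- `g` has finite one-sided limits at `Tc`, and the limit from above minus the limit from below
is `Δ`. -/
def HasCriticalGap (g : ℝ → ℝ) (Tc Δ : ℝ) : Prop :=
  ∃ above below : ℝ, Tendsto g (𝓝[>] Tc) (𝓝 above) ∧ Tendsto g (𝓝[<] Tc) (𝓝 below) ∧
    above - below = Δ

/-- First-order transition: the free energy is continuous and has unequal left and right
derivatives. -/
def HasFirstOrderTransition (f : ℝ → ℝ) (ηc : ℝ) : Prop :=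
  ContinuousAt f ηc ∧ ∃ l r : ℝ,
    HasDerivWithinAt f l (Iio ηc) ηc ∧ HasDerivWithinAt f r (Ioi ηc) ηc ∧ l ≠ r

end IsingCylinder

end

open IsingCylinder

/-! By Jensen's formula the circle average of ln(a − x cos φ − y sin φ) is ln((a + √(a² − x² −
y²))/2), so every mode becomes elementary (`integral_log_sub_cos_sub_sin`, `modeFreeEnergy_eq`). It
can lose smoothness only where its discriminant vanishes. Since A₁ > 0, the discriminant is positive
for all η > 0 when cos(2πp/L) ≠ 1 (`modeDisc_pos`); this settles PJC and all nonzero AJC modes.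

For p = 0 put h = α₀ − α₁ and c = α₂ + α₃ (`hotBranch`, `coldBranch`). Then A₀ − A₁ = h² + c² and A₂
+ A₃ = 2hc, so the critical equation reads (h − c)² = 0, the discriminant is (h² − c²)², and f₀ =
−(1/sL) ln max(h, c). As h decreases strictly and c increases strictly, they cross exactly once, and
f is two C² branches glued at η_c (`isGluing_freeEnergy`).

The branches differ by (1/sL) ln(c/h). Its first derivative is a_ε/(sL) at every η > 0, not only at
η_c (`hasDerivAt_logRatio`), so differentiating a_ε itself yields the jump of c (`hasDerivAt_aε`).
Finally G(0, η) = 2hc/(h² + c²) makes D_ε equal to sign(h − c) a_ε, whose sign flip reproduces both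
jumps. -/

namespace IsingCylinder

/-! ### Jensen's formula, the hyperbolic tangent, and gluing of C² functions -/

section Analysis

/-- The circle average of the logarithm of a nonnegative trigonometric polynomial of degree one. -/
theorem integral_log_sub_cos_sub_sin {a x y : ℝ} (ha : 0 < a) (h : x ^ 2 + y ^ 2 ≤ a ^ 2) :
    (∫ φ in (0 : ℝ)..(2 * Real.pi), Real.log (a - x * Real.cos φ - y * Real.sin φ))
      / (2 * Real.pi) = Real.log ((a + √(a ^ 2 - (x ^ 2 + y ^ 2))) / 2) := by
  set w := √(a ^ 2 - (x ^ 2 + y ^ 2)) with hw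
  have hw0 : 0 ≤ w := Real.sqrt_nonneg _
  have hw2 : w ^ 2 = a ^ 2 - (x ^ 2 + y ^ 2) := Real.sq_sqrt (by linarith)
  -- The larger root of k² − ak + (x² + y²)/4 = 0: with ρ² = k and v = (x + iy)/(2ρ), the argument
  -- of the logarithm is |ρe^{iφ} − v|², and taking the larger root puts v in the disc of radius ρ.
  set k := (a + w) / 2 with hk
  have hk0 : 0 < k := by positivity
  set ρ := √k with hρ
  have hρ0 : 0 < ρ := Real.sqrt_pos.2 hk0
  have hρ2 : ρ ^ 2 = k := Real.sq_sqrt hk0.le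
  have hρ4 : 4 * ρ ^ 2 * ρ ^ 2 + (x ^ 2 + y ^ 2) = 4 * a * ρ ^ 2 := by
    rw [hρ2, hk]; linear_combination hw2
  set v : ℂ := ⟨x / (2 * ρ), y / (2 * ρ)⟩ with hv
  have hvn : ‖v‖ ^ 2 = (x ^ 2 + y ^ 2) / (4 * ρ ^ 2) := by
    rw [← Complex.normSq_eq_norm_sq, Complex.normSq_apply, hv]
    field_simp; ring
  have hvρ : ‖v‖ ≤ ρ := by
    apply le_of_sq_le_sq _ hρ0.le
    rw [hvn, div_le_iff₀ (by positivity)]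
    have : a ≤ 2 * ρ ^ 2 := by rw [hρ2, hk]; linarith
    nlinarith [sq_nonneg ρ]
  have key : ∀ φ : ℝ, Real.log (a - x * Real.cos φ - y * Real.sin φ)
      = 2 * Real.log ‖circleMap 0 ρ φ - v‖ := by
    intro φ
    rw [show (2 : ℝ) * Real.log ‖circleMap 0 ρ φ - v‖ = Real.log (‖circleMap 0 ρ φ - v‖ ^ 2) by
      rw [Real.log_pow]; norm_num]
    congr 1
    rw [← Complex.normSq_eq_norm_sq, Complex.normSq_apply]
    have hre : (circleMap 0 ρ φ - v).re = ρ * Real.cos φ - x / (2 * ρ) := by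
      simp [circleMap, hv, Complex.exp_ofReal_mul_I_re]
    have him : (circleMap 0 ρ φ - v).im = ρ * Real.sin φ - y / (2 * ρ) := by
      simp [circleMap, hv, Complex.exp_ofReal_mul_I_im]
    rw [hre, him]
    have hcs := Real.sin_sq_add_cos_sq φ
    field_simp
    linear_combination (-1) * hρ4 - 4 * ρ ^ 4 * hcs
  -- The closed disc is needed: at criticality the zero mode has |v| = ρ, a logarithmic singularity
  -- on the circle.
  have hav := circleAverage_log_norm_sub_const_of_mem_closedBall (a := v) (c := 0) (R := ρ)
    (by simpa [abs_of_pos hρ0] using hvρ)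
  rw [Real.circleAverage_def, smul_eq_mul] at hav
  simp_rw [key]
  rw [intervalIntegral.integral_const_mul, ← hρ2, Real.log_pow, ← hav]
  field_simp
  push_cast
  ring

theorem contDiff_tanh {n : WithTop ℕ∞} : ContDiff ℝ n Real.tanh := by
  have : Real.tanh = fun x => Real.sinh x / Real.cosh x :=
    funext Real.tanh_eq_sinh_div_cosh
  rw [this]
  exact Real.contDiff_sinh.div Real.contDiff_cosh fun x => (Real.cosh_pos x).ne'

theorem hasDerivAt_tanh (x : ℝ) : HasDerivAt Real.tanh (1 - Real.tanh x ^ 2) x := by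
  have h : Real.tanh = fun x => Real.sinh x / Real.cosh x :=
    funext Real.tanh_eq_sinh_div_cosh
  have hc := (Real.cosh_pos x).ne'
  rw [Real.tanh_eq_sinh_div_cosh, h]
  exact ((Real.hasDerivAt_sinh x).div (Real.hasDerivAt_cosh x) hc).congr_deriv (by field_simp)

theorem strictMono_tanh : StrictMono Real.tanh :=
  strictMono_of_deriv_pos fun x => by
    rw [(hasDerivAt_tanh x).deriv]; linarith [Real.tanh_sq_lt_one x]

theorem tanh_pos {x : ℝ} (hx : 0 < x) : 0 < Real.tanh x := by
  simpa using strictMono_tanh hx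

theorem tanh_nonneg {x : ℝ} (hx : 0 ≤ x) : 0 ≤ Real.tanh x := by
  simpa using strictMono_tanh.monotone hx

theorem tendsto_tanh_atTop : Tendsto Real.tanh atTop (𝓝 1) := by
  refine tendsto_order.2 ⟨fun a ha => ?_, fun a ha =>
    Eventually.of_forall fun x => (Real.tanh_lt_one x).trans ha⟩
  -- The maximum with 0 covers a ≤ −1, which is outside the range of tanh.
  obtain ⟨x, -, hx⟩ := Real.tanh_surjOn (show max a 0 ∈ Ioo (-1 : ℝ) 1 from
    ⟨by linarith [le_max_right a 0], max_lt ha one_pos⟩)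
  filter_upwards [eventually_gt_atTop x] with y hy
  exact (le_max_left a 0).trans_lt (hx ▸ strictMono_tanh hy)

variable {f g U V : ℝ → ℝ} {c : ℝ}

theorem continuousAt_deriv_of_contDiffOn (hU : ContDiffOn ℝ 2 U (Ioi 0)) (hc : 0 < c) :
    ContinuousAt (deriv U) c :=
  (hU.continuousOn_deriv_of_isOpen isOpen_Ioi (by norm_num)).continuousAt (Ioi_mem_nhds hc)

theorem continuousAt_deriv_deriv_of_contDiffOn (hU : ContDiffOn ℝ 2 U (Ioi 0)) (hc : 0 < c) :
    ContinuousAt (deriv (deriv U)) c :=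
  ((hU.deriv_of_isOpen (m := 1) isOpen_Ioi (by norm_num)).continuousOn_deriv_of_isOpen
    isOpen_Ioi le_rfl).continuousAt (Ioi_mem_nhds hc)

theorem differentiableAt_of_contDiffOn (hU : ContDiffOn ℝ 2 U (Ioi 0)) (hc : 0 < c) :
    DifferentiableAt ℝ U c :=
  (hU.contDiffAt (Ioi_mem_nhds hc)).differentiableAt (by norm_num)

theorem differentiableAt_deriv_of_contDiffOn (hU : ContDiffOn ℝ 2 U (Ioi 0)) (hc : 0 < c) :
    DifferentiableAt ℝ (deriv U) c :=
  ((hU.deriv_of_isOpen (m := 1) isOpen_Ioi (by norm_num)).contDiffAt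
    (Ioi_mem_nhds hc)).differentiableAt (by norm_num)

theorem eqOn_deriv_of_isOpen {s : Set ℝ} (hs : IsOpen s) (h : EqOn f U s) :
    EqOn (deriv f) (deriv U) s := fun _ hx =>
  (h.eventuallyEq_of_mem (hs.mem_nhds hx)).deriv_eq

/-- The point c may be an endpoint of s: derivatives of f and U agree on the open set s, and those
of U are continuous across c, so the one-sided limits can be read off from U at c. -/
theorem tendsto_deriv_of_eqOn {s : Set ℝ} {l : Filter ℝ} (hs : IsOpen s) (hl : l ≤ 𝓝 c)
    (hsl : s ∈ l) (h : EqOn f U s) (hU : ContDiffOn ℝ 2 U (Ioi 0)) (hc : 0 < c) :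
    Tendsto (deriv f) l (𝓝 (deriv U c)) ∧
      Tendsto (fun x => -x ^ 2 * deriv (deriv f) x) l (𝓝 (-c ^ 2 * deriv (deriv U) c)) := by
  have h1 := eqOn_deriv_of_isOpen hs h
  have h2 := eqOn_deriv_of_isOpen hs h1
  constructor
  · exact (((continuousAt_deriv_of_contDiffOn hU hc).tendsto).mono_left hl).congr'
      ((h1.eventuallyEq_of_mem hsl).symm)
  · have hcont : ContinuousAt (fun x => -x ^ 2 * deriv (deriv U) x) c :=
      (by fun_prop : ContinuousAt (fun x : ℝ => -x ^ 2) c).mul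
        (continuousAt_deriv_deriv_of_contDiffOn hU hc)
    refine (hcont.tendsto.mono_left hl).congr' ?_
    filter_upwards [hsl] with x hx
    rw [h2 hx]

/-- Two `C²` branches glued at `c`. -/
structure IsGluing (f U V : ℝ → ℝ) (c : ℝ) : Prop where
  pos : 0 < c
  left : ContDiffOn ℝ 2 U (Ioi 0)
  right : ContDiffOn ℝ 2 V (Ioi 0)
  eqOn_left : EqOn f U (Ioc 0 c)
  eqOn_right : EqOn f V (Ici c)

namespace IsGluing

theorem hasDerivWithinAt_left (h : IsGluing f U V c) :
    HasDerivWithinAt f (deriv U c) (Iio c) c := by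
  refine ((differentiableAt_of_contDiffOn h.left h.pos).hasDerivAt.hasDerivWithinAt
    (s := Iio c)).congr_of_eventuallyEq ?_ (h.eqOn_left ⟨h.pos, le_rfl⟩)
  filter_upwards [Ioo_mem_nhdsLT h.pos] with x hx using h.eqOn_left ⟨hx.1, hx.2.le⟩

theorem hasDerivWithinAt_right (h : IsGluing f U V c) :
    HasDerivWithinAt f (deriv V c) (Ioi c) c := by
  refine ((differentiableAt_of_contDiffOn h.right h.pos).hasDerivAt.hasDerivWithinAt
    (s := Ioi c)).congr (fun x hx => h.eqOn_right (Ioi_subset_Ici_self hx)) (h.eqOn_right self_mem_Ici)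

theorem contDiffOn (h : IsGluing f U V c) : ContDiffOn ℝ 2 f (Ioi 0 \ {c}) := by
  rintro x ⟨hx0, hxc⟩
  rw [mem_singleton_iff] at hxc
  refine ContDiffAt.contDiffWithinAt ?_
  rcases lt_or_gt_of_ne hxc with hlt | hgt
  · refine (h.left.contDiffAt (Ioi_mem_nhds hx0)).congr_of_eventuallyEq ?_
    filter_upwards [Ioo_mem_nhds hx0 hlt] with y hy using h.eqOn_left ⟨hy.1, hy.2.le⟩
  · refine (h.right.contDiffAt (Ioi_mem_nhds hx0)).congr_of_eventuallyEq ?_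
    filter_upwards [Ioi_mem_nhds hgt] with y hy using h.eqOn_right (Ioi_subset_Ici_self hy)

theorem continuousAt (h : IsGluing f U V c) : ContinuousAt f c :=
  continuousAt_iff_continuous_left'_right'.2
    ⟨h.hasDerivWithinAt_left.continuousWithinAt, h.hasDerivWithinAt_right.continuousWithinAt⟩

theorem continuousOn (h : IsGluing f U V c) : ContinuousOn f (Ioi 0) := by
  intro x hx
  refine ContinuousAt.continuousWithinAt ?_
  by_cases hxc : x = c
  · exact hxc ▸ h.continuousAt
  · exact (h.contDiffOn.contDiffAt
      ((isOpen_Ioi.sdiff isClosed_singleton).mem_nhds ⟨hx, hxc⟩)).continuousAt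

theorem tendsto_left (h : IsGluing f U V c) :
    Tendsto (deriv f) (𝓝[<] c) (𝓝 (deriv U c)) ∧
      Tendsto (fun x => -x ^ 2 * deriv (deriv f) x) (𝓝[<] c)
        (𝓝 (-c ^ 2 * deriv (deriv U) c)) :=
  tendsto_deriv_of_eqOn isOpen_Ioo nhdsWithin_le_nhds (Ioo_mem_nhdsLT h.pos)
    (h.eqOn_left.mono Ioo_subset_Ioc_self) h.left h.pos

theorem tendsto_right (h : IsGluing f U V c) :
    Tendsto (deriv f) (𝓝[>] c) (𝓝 (deriv V c)) ∧
      Tendsto (fun x => -x ^ 2 * deriv (deriv f) x) (𝓝[>] c)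
        (𝓝 (-c ^ 2 * deriv (deriv V) c)) :=
  tendsto_deriv_of_eqOn isOpen_Ioi nhdsWithin_le_nhds self_mem_nhdsWithin
    (h.eqOn_right.mono Ioi_subset_Ici_self) h.right h.pos

end IsGluing

theorem not_hasFirstOrderTransition_of_differentiableAt (h : DifferentiableAt ℝ f c) :
    ¬ HasFirstOrderTransition f c := by
  rintro ⟨-, l, r, hl, hr, hlr⟩
  apply hlr
  rw [(uniqueDiffWithinAt_Iio c).eq_deriv _ hl h.hasDerivAt.hasDerivWithinAt,
    (uniqueDiffWithinAt_Ioi c).eq_deriv _ hr h.hasDerivAt.hasDerivWithinAt]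

/-- Passing to the temperature `T = A / (kB η)` exchanges the two sides of the critical point. -/
theorem hasCriticalGap_comp_div {A kB a b : ℝ} (hA : 0 < A) (hkB : 0 < kB) (hc : 0 < c)
    (hl : Tendsto g (𝓝[<] c) (𝓝 a)) (hr : Tendsto g (𝓝[>] c) (𝓝 b)) :
    HasCriticalGap (fun T => g (A / (kB * T))) (A / (kB * c)) (a - b) := by
  have hT : 0 < A / (kB * c) := by positivity
  have hinv : A / (kB * (A / (kB * c))) = c := by field_simp
  have hcont : ContinuousAt (fun T => A / (kB * T)) (A / (kB * c)) := by
    refine continuousAt_const.div (by fun_prop) (by positivity)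
  have hcont' : Tendsto (fun T => A / (kB * T)) (𝓝 (A / (kB * c))) (𝓝 c) := by
    simpa only [ContinuousAt, hinv] using hcont
  refine ⟨a, b, hl.comp ?_, hr.comp ?_, rfl⟩
  · refine tendsto_nhdsWithin_iff.2 ⟨hcont'.mono_left nhdsWithin_le_nhds, ?_⟩
    filter_upwards [self_mem_nhdsWithin] with T hTc
    have hTc' : A / (kB * c) < T := hTc
    have hT0 : 0 < T := hT.trans hTc'
    rw [mem_Iio, div_lt_iff₀ (by positivity)]
    rw [div_lt_iff₀ (by positivity)] at hTc'
    linarith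
  · refine tendsto_nhdsWithin_iff.2 ⟨hcont'.mono_left nhdsWithin_le_nhds, ?_⟩
    filter_upwards [Ioo_mem_nhdsLT hT] with T hTc
    have hT0 : 0 < T := hTc.1
    have hTc' := hTc.2
    rw [mem_Ioi, lt_div_iff₀ (by positivity)]
    rw [lt_div_iff₀ (by positivity)] at hTc'
    linarith

end Analysis

/-! ### The two branches of the zero mode and the critical point -/

section Branches

variable {Λ : Lattice} {J : Couplings} {η : ℝ}

theorem Jref_pos (hJ : J.Ferromagnetic Λ) : 0 < Jref Λ J := by
  cases Λ <;> obtain ⟨h1, h2, h3⟩ := hJ <;> assumption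

theorem J₁_pos (hJ : J.Ferromagnetic Λ) : 0 < J.J₁ := by
  cases Λ <;> exact hJ.1

theorem J₂_pos (hJ : J.Ferromagnetic Λ) : 0 < J.J₂ := by
  cases Λ <;> exact hJ.2.1

theorem J₃_nonneg (hJ : J.Ferromagnetic Λ) : 0 ≤ J.J₃ := by
  cases Λ
  · exact hJ.2.2.le
  · exact hJ.2.2.ge
  · exact hJ.2.2.le

theorem t₁_pos (hJ : J.Ferromagnetic Λ) (hη : 0 < η) : 0 < t₁ Λ J η :=
  tanh_pos (mul_pos (div_pos (J₁_pos hJ) (Jref_pos hJ)) hη)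

theorem t₂_pos (hJ : J.Ferromagnetic Λ) (hη : 0 < η) : 0 < t₂ Λ J η :=
  tanh_pos (mul_pos (div_pos (J₂_pos hJ) (Jref_pos hJ)) hη)

theorem t₃_nonneg (hJ : J.Ferromagnetic Λ) (hη : 0 < η) : 0 ≤ t₃ Λ J η :=
  tanh_nonneg (mul_nonneg (div_nonneg (J₃_nonneg hJ) (Jref_pos hJ).le) hη.le)

theorem t₃_pos (hJ : J.Ferromagnetic .hexagonal) (hη : 0 < η) : 0 < t₃ .hexagonal J η :=
  tanh_pos (mul_pos (div_pos hJ.2.2 (Jref_pos hJ)) hη)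

theorem t₁_lt_one : t₁ Λ J η < 1 := Real.tanh_lt_one _

theorem t₂_lt_one : t₂ Λ J η < 1 := Real.tanh_lt_one _

theorem t₃_lt_one : t₃ Λ J η < 1 := Real.tanh_lt_one _

theorem contDiff_t₁ : ContDiff ℝ 2 (t₁ Λ J) := contDiff_tanh.comp (contDiff_const.mul contDiff_id)

theorem contDiff_t₂ : ContDiff ℝ 2 (t₂ Λ J) := contDiff_tanh.comp (contDiff_const.mul contDiff_id)

theorem contDiff_t₃ : ContDiff ℝ 2 (t₃ Λ J) := contDiff_tanh.comp (contDiff_const.mul contDiff_id)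

theorem hasDerivAt_tanh_const_mul (r x : ℝ) :
    HasDerivAt (fun x => Real.tanh (r * x)) (r * (1 - Real.tanh (r * x) ^ 2)) x := by
  have h := (hasDerivAt_tanh (r * x)).comp x ((hasDerivAt_id x).const_mul r)
  exact h.congr_deriv (by ring)

theorem hasDerivAt_t₁ : HasDerivAt (t₁ Λ J) (J.J₁ / Jref Λ J * (1 - t₁ Λ J η ^ 2)) η :=
  hasDerivAt_tanh_const_mul _ _

theorem hasDerivAt_t₂ : HasDerivAt (t₂ Λ J) (J.J₂ / Jref Λ J * (1 - t₂ Λ J η ^ 2)) η :=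
  hasDerivAt_tanh_const_mul _ _

theorem hasDerivAt_t₃ : HasDerivAt (t₃ Λ J) (J.J₃ / Jref Λ J * (1 - t₃ Λ J η ^ 2)) η :=
  hasDerivAt_tanh_const_mul _ _

theorem t₁_strictMono (hJ : J.Ferromagnetic Λ) : StrictMono (t₁ Λ J) := fun _ _ h =>
  strictMono_tanh (mul_lt_mul_of_pos_left h (div_pos (J₁_pos hJ) (Jref_pos hJ)))

theorem t₂_strictMono (hJ : J.Ferromagnetic Λ) : StrictMono (t₂ Λ J) := fun _ _ h =>
  strictMono_tanh (mul_lt_mul_of_pos_left h (div_pos (J₂_pos hJ) (Jref_pos hJ)))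

theorem t₃_monotone (hJ : J.Ferromagnetic Λ) : Monotone (t₃ Λ J) := fun _ _ h =>
  strictMono_tanh.monotone
    (mul_le_mul_of_nonneg_left h (div_nonneg (J₃_nonneg hJ) (Jref_pos hJ).le))

theorem tendsto_t₁ (hJ : J.Ferromagnetic Λ) : Tendsto (t₁ Λ J) atTop (𝓝 1) :=
  tendsto_tanh_atTop.comp (tendsto_id.const_mul_atTop (div_pos (J₁_pos hJ) (Jref_pos hJ)))

theorem tendsto_t₃ (hJ : J.Ferromagnetic .hexagonal) :
    Tendsto (t₃ .hexagonal J) atTop (𝓝 1) :=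
  tendsto_tanh_atTop.comp (tendsto_id.const_mul_atTop (div_pos hJ.2.2 (Jref_pos hJ)))

theorem contDiff_α₀ : ContDiff ℝ 2 (α₀ Λ J) := by
  have h1 := contDiff_t₁ (Λ := Λ) (J := J)
  have h2 := contDiff_t₂ (Λ := Λ) (J := J)
  have h3 := contDiff_t₃ (Λ := Λ) (J := J)
  cases Λ <;> unfold α₀ <;> fun_prop

theorem contDiff_α₁ : ContDiff ℝ 2 (α₁ Λ J) := by
  have h1 := contDiff_t₁ (Λ := Λ) (J := J)
  have h2 := contDiff_t₂ (Λ := Λ) (J := J)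
  have h3 := contDiff_t₃ (Λ := Λ) (J := J)
  cases Λ <;> unfold α₁ <;> fun_prop

theorem contDiff_α₂ : ContDiff ℝ 2 (α₂ Λ J) := by
  have h1 := contDiff_t₁ (Λ := Λ) (J := J)
  have h2 := contDiff_t₂ (Λ := Λ) (J := J)
  have h3 := contDiff_t₃ (Λ := Λ) (J := J)
  cases Λ <;> unfold α₂ <;> fun_prop

theorem contDiff_α₃ : ContDiff ℝ 2 (α₃ Λ J) := by
  have h1 := contDiff_t₁ (Λ := Λ) (J := J)
  have h2 := contDiff_t₂ (Λ := Λ) (J := J)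
  have h3 := contDiff_t₃ (Λ := Λ) (J := J)
  cases Λ <;> unfold α₃ <;> fun_prop

variable (Λ J) in
/-- The square root of the dominant eigenvalue of the zero mode above the critical temperature. -/
noncomputable def hotBranch (η : ℝ) : ℝ := α₀ Λ J η - α₁ Λ J η

variable (Λ J) in
/-- The square root of the dominant eigenvalue of the zero mode below the critical temperature. -/
noncomputable def coldBranch (η : ℝ) : ℝ := α₂ Λ J η + α₃ Λ J η

theorem contDiff_hotBranch : ContDiff ℝ 2 (hotBranch Λ J) := contDiff_α₀.sub contDiff_α₁

theorem contDiff_coldBranch : ContDiff ℝ 2 (coldBranch Λ J) := contDiff_α₂.add contDiff_α₃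

/-- Together with `A₂_add_A₃` this turns the zero mode into perfect squares: sum and difference of
the two quantities are (h ± c)². -/
theorem A₀_sub_A₁ : A₀ Λ J η - A₁ Λ J η = hotBranch Λ J η ^ 2 + coldBranch Λ J η ^ 2 := by
  unfold A₀ A₁ hotBranch coldBranch; ring

theorem A₂_add_A₃ : A₂ Λ J η + A₃ Λ J η = 2 * hotBranch Λ J η * coldBranch Λ J η := by
  unfold A₂ A₃ hotBranch coldBranch; ring

theorem isCritical_iff : IsCritical Λ J η ↔ 0 < η ∧ hotBranch Λ J η = coldBranch Λ J η := by
  have h : A₀ Λ J η - A₁ Λ J η - A₂ Λ J η - A₃ Λ J η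
      = (hotBranch Λ J η - coldBranch Λ J η) ^ 2 := by
    linear_combination A₀_sub_A₁ (Λ := Λ) (J := J) (η := η)
      - A₂_add_A₃ (Λ := Λ) (J := J) (η := η)
  rw [IsCritical, h, sq_eq_zero_iff, sub_eq_zero]

/-- In this and the following factorizations each factor is monotone in every tᵢ, so sign and
monotonicity in η can be read off factor by factor. -/
theorem hotBranch_triangular : hotBranch .triangular J η =
    (1 - t₁ .triangular J η) * (1 - t₂ .triangular J η * t₃ .triangular J η) := by
  simp only [hotBranch, α₀, α₁]; ring

theorem hotBranch_square : hotBranch .square J η =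
    (1 - t₁ .square J η) * (1 - t₂ .square J η * t₃ .square J η) := by
  simp only [hotBranch, α₀, α₁]; ring

theorem hotBranch_hexagonal : hotBranch .hexagonal J η =
    1 - t₃ .hexagonal J η * t₁ .hexagonal J η := by
  simp only [hotBranch, α₀, α₁]

theorem coldBranch_triangular : coldBranch .triangular J η =
    (1 + t₁ .triangular J η) * (t₂ .triangular J η + t₃ .triangular J η) := by
  simp only [coldBranch, α₂, α₃]; ring

theorem coldBranch_square : coldBranch .square J η =
    (1 + t₁ .square J η) * (t₂ .square J η + t₃ .square J η) := by
  simp only [coldBranch, α₂, α₃]; ring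

theorem coldBranch_hexagonal : coldBranch .hexagonal J η =
    t₂ .hexagonal J η * (t₃ .hexagonal J η + t₁ .hexagonal J η) := by
  simp only [coldBranch, α₂, α₃]; ring

theorem one_sub_mul_pos {x y : ℝ} (hy : 0 ≤ y) (hx1 : x < 1) (hy1 : y < 1) :
    0 < 1 - x * y := by nlinarith

theorem hotBranch_pos (hJ : J.Ferromagnetic Λ) (hη : 0 < η) : 0 < hotBranch Λ J η := by
  cases Λ
  · rw [hotBranch_triangular]
    exact mul_pos (sub_pos.2 t₁_lt_one) (one_sub_mul_pos (t₃_nonneg hJ hη) t₂_lt_one t₃_lt_one)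
  · rw [hotBranch_square]
    exact mul_pos (sub_pos.2 t₁_lt_one) (one_sub_mul_pos (t₃_nonneg hJ hη) t₂_lt_one t₃_lt_one)
  · rw [hotBranch_hexagonal]
    exact one_sub_mul_pos (t₁_pos hJ hη).le t₃_lt_one t₁_lt_one

theorem coldBranch_pos (hJ : J.Ferromagnetic Λ) (hη : 0 < η) : 0 < coldBranch Λ J η := by
  have h1 := t₁_pos hJ hη
  have h2 := t₂_pos hJ hη
  have h3 := t₃_nonneg hJ hη
  cases Λ
  · rw [coldBranch_triangular]; positivity
  · rw [coldBranch_square]; positivity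
  · rw [coldBranch_hexagonal]; positivity

theorem hotBranch_lt {x y : ℝ} (hJ : J.Ferromagnetic Λ) (hx : 0 < x) (hxy : x < y) :
    hotBranch Λ J y < hotBranch Λ J x := by
  have hy := hx.trans hxy
  have h1 := t₁_strictMono hJ hxy
  have h2 := t₂_strictMono hJ hxy
  have h3 := t₃_monotone hJ hxy.le
  have p3 := t₃_nonneg hJ hx
  cases Λ
  · rw [hotBranch_triangular, hotBranch_triangular]
    -- Strictness comes from 1 − t₁ alone; t₂t₃ is only weakly monotone here, since t₃ vanishes
    -- identically on the square lattice.
    refine mul_lt_mul (by linarith) ?_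
      (one_sub_mul_pos (t₃_nonneg hJ hy) t₂_lt_one t₃_lt_one)
      (sub_nonneg.2 t₁_lt_one.le)
    have := mul_le_mul h2.le h3 p3 (t₂_pos hJ hy).le
    linarith
  · rw [hotBranch_square, hotBranch_square]
    refine mul_lt_mul (by linarith) ?_
      (one_sub_mul_pos (t₃_nonneg hJ hy) t₂_lt_one t₃_lt_one)
      (sub_nonneg.2 t₁_lt_one.le)
    have := mul_le_mul h2.le h3 p3 (t₂_pos hJ hy).le
    linarith
  · rw [hotBranch_hexagonal, hotBranch_hexagonal]
    have := mul_lt_mul' h3 h1 (t₁_pos hJ hx).le (t₃_pos hJ hy)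
    linarith

theorem coldBranch_lt {x y : ℝ} (hJ : J.Ferromagnetic Λ) (hx : 0 < x) (hxy : x < y) :
    coldBranch Λ J x < coldBranch Λ J y := by
  have hy := hx.trans hxy
  have h1 := t₁_strictMono hJ hxy
  have h2 := t₂_strictMono hJ hxy
  have h3 := t₃_monotone hJ hxy.le
  have p1 := t₁_pos hJ hx
  have p2 := t₂_pos hJ hx
  have p3 := t₃_nonneg hJ hx
  cases Λ
  · rw [coldBranch_triangular, coldBranch_triangular]
    exact mul_lt_mul'' (by linarith) (by linarith) (by linarith) (by linarith)
  · rw [coldBranch_square, coldBranch_square]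
    exact mul_lt_mul'' (by linarith) (by linarith) (by linarith) (by linarith)
  · rw [coldBranch_hexagonal, coldBranch_hexagonal]
    exact mul_lt_mul'' (by linarith) (by linarith) (by linarith) (by linarith)

/-- A vanishing majorant is all that the existence of a crossing requires; on the triangular and
square lattices 1 − t₁ serves, with no limit of t₂ or t₃. -/
theorem tendsto_hotBranch (hJ : J.Ferromagnetic Λ) : ∃ l : ℝ → ℝ, Tendsto l atTop (𝓝 0) ∧
    ∀ η, 0 < η → hotBranch Λ J η ≤ l η := by
  cases Λ
  · refine ⟨fun η => 1 - t₁ .triangular J η, by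
      simpa using (tendsto_t₁ hJ).const_sub 1, fun η hη => ?_⟩
    rw [hotBranch_triangular]
    refine mul_le_of_le_one_right (sub_nonneg.2 t₁_lt_one.le) ?_
    linarith [mul_nonneg (t₂_pos hJ hη).le (t₃_nonneg hJ hη)]
  · refine ⟨fun η => 1 - t₁ .square J η, by
      simpa using (tendsto_t₁ hJ).const_sub 1, fun η hη => ?_⟩
    rw [hotBranch_square]
    refine mul_le_of_le_one_right (sub_nonneg.2 t₁_lt_one.le) ?_
    linarith [mul_nonneg (t₂_pos hJ hη).le (t₃_nonneg hJ hη)]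
  · exact ⟨fun η => 1 - t₃ .hexagonal J η * t₁ .hexagonal J η, by
      simpa using ((tendsto_t₃ hJ).mul (tendsto_t₁ hJ)).const_sub 1,
      fun η _ => hotBranch_hexagonal.le⟩

theorem branches_at_zero : coldBranch Λ J 0 < hotBranch Λ J 0 := by
  cases Λ <;> simp [coldBranch, hotBranch, α₀, α₁, α₂, α₃, t₁, t₂, t₃, η₁, η₂, η₃]

theorem coldBranch_lt_hotBranch {ηc : ℝ} (hJ : J.Ferromagnetic Λ) (hc : IsCritical Λ J ηc)
    (hη : 0 < η) (h : η < ηc) : coldBranch Λ J η < hotBranch Λ J η := by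
  have := (isCritical_iff.1 hc).2
  linarith [hotBranch_lt hJ hη h, coldBranch_lt hJ hη h]

theorem hotBranch_lt_coldBranch {ηc : ℝ} (hJ : J.Ferromagnetic Λ) (hc : IsCritical Λ J ηc)
    (h : ηc < η) : hotBranch Λ J η < coldBranch Λ J η := by
  have := (isCritical_iff.1 hc).2
  linarith [hotBranch_lt hJ hc.1 h, coldBranch_lt hJ hc.1 h]

theorem existsUnique_isCritical (hJ : J.Ferromagnetic Λ) : ∃! ηc, IsCritical Λ J ηc := by
  obtain ⟨l, hl, hle⟩ := tendsto_hotBranch hJ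
  -- The point b > 1 is chosen so that h(b) ≤ l(b) < c(1) < c(b), opposite to the order h(0) > c(0).
  obtain ⟨b, hb1, hb⟩ := ((eventually_gt_atTop (1 : ℝ)).and
    (hl.eventually (gt_mem_nhds (coldBranch_pos hJ one_pos)))).exists
  have hb0 : 0 < b := one_pos.trans hb1
  have hend : hotBranch Λ J b - coldBranch Λ J b < 0 := by
    linarith [hle b hb0, coldBranch_lt hJ one_pos hb1]
  have hstart : 0 < hotBranch Λ J 0 - coldBranch Λ J 0 := sub_pos.2 branches_at_zero
  obtain ⟨c, hc, hc0⟩ := intermediate_value_Icc' hb0.le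
    ((contDiff_hotBranch.sub contDiff_coldBranch).continuous.continuousOn
      (s := Icc 0 b) (f := fun x => hotBranch Λ J x - coldBranch Λ J x)) ⟨hend.le, hstart.le⟩
  have hcpos : 0 < c := hc.1.lt_of_ne fun h => by
    subst h
    exact hstart.ne' hc0
  have hcrit : IsCritical Λ J c := isCritical_iff.2 ⟨hcpos, sub_eq_zero.1 hc0⟩
  refine ⟨c, hcrit, fun y hy => ?_⟩
  rcases lt_trichotomy y c with h | h | h
  · exact absurd (isCritical_iff.1 hy).2 (coldBranch_lt_hotBranch hJ hcrit hy.1 h).ne'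
  · exact h
  · exact absurd (isCritical_iff.1 hy).2 (hotBranch_lt_coldBranch hJ hcrit h).ne

end Branches

/-! ### Positivity of the amplitudes and the derivatives behind them -/

section Amplitudes

variable {Λ : Lattice} {J : Couplings} {η : ℝ}

theorem aε_pos (hJ : J.Ferromagnetic Λ) (hη : 0 < η) : 0 < aε Λ J η := by
  have h1 := t₁_pos hJ hη
  have h2 := t₂_pos hJ hη
  have h3 := t₃_nonneg hJ hη
  have j1 := J₁_pos hJ
  have j2 := J₂_pos hJ
  have j3 := J₃_nonneg hJ
  have l1 : 0 < 1 - t₁ Λ J η ^ 2 := sub_pos.2 (Real.tanh_sq_lt_one _)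
  have l2 : 0 < 1 - t₂ Λ J η ^ 2 := sub_pos.2 (Real.tanh_sq_lt_one _)
  have l3 : 0 < 1 - t₃ Λ J η ^ 2 := sub_pos.2 (Real.tanh_sq_lt_one _)
  have l23 : 0 < 1 - t₂ Λ J η * t₃ Λ J η := one_sub_mul_pos h3 t₂_lt_one t₃_lt_one
  have l13 : 0 < 1 - t₁ Λ J η * t₃ Λ J η := one_sub_mul_pos h3 t₁_lt_one t₃_lt_one
  cases Λ <;> simp only [aε] <;> positivity

theorem ac_pos (hJ : J.Ferromagnetic Λ) (hη : 0 < η) : 0 < ac Λ J η := by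
  have h1 := t₁_pos hJ hη
  have h2 := t₂_pos hJ hη
  have h3 := t₃_nonneg hJ hη
  have j1 := J₁_pos hJ
  have j2 := J₂_pos hJ
  have j3 := J₃_nonneg hJ
  have l1 : 0 < 1 - t₁ Λ J η ^ 2 := sub_pos.2 (Real.tanh_sq_lt_one _)
  have l2 : 0 < 1 - t₂ Λ J η ^ 2 := sub_pos.2 (Real.tanh_sq_lt_one _)
  have l3 : 0 < 1 - t₃ Λ J η ^ 2 := sub_pos.2 (Real.tanh_sq_lt_one _)
  have m1 : 0 < 1 - t₁ Λ J η ^ 4 := by nlinarith [sq_nonneg (t₁ Λ J η)]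
  have m2 : 0 < 1 - t₂ Λ J η ^ 4 := by nlinarith [sq_nonneg (t₂ Λ J η)]
  have m3 : 0 < 1 - t₃ Λ J η ^ 4 := by nlinarith [sq_nonneg (t₃ Λ J η)]
  have l23 : 0 < 1 - t₂ Λ J η * t₃ Λ J η := one_sub_mul_pos h3 t₂_lt_one t₃_lt_one
  have l13 : 0 < 1 - t₁ Λ J η * t₃ Λ J η := one_sub_mul_pos h3 t₁_lt_one t₃_lt_one
  cases Λ <;> simp only [ac]
  -- The squared difference vanishes when J₂ = J₃, so positivity rests on the cross term. On the
  -- square lattice it is the reverse: the cross term vanishes and the square is r₂₁².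
  · have j3' : 0 < J.J₃ := hJ.2.2
    positivity
  · have j3' : J.J₃ = 0 := hJ.2.2
    have : 0 < J.J₂ / J.J₁ := by positivity
    rw [j3', zero_div, zero_sub, neg_sq, mul_zero, zero_mul, zero_mul, add_zero]
    positivity
  · positivity

/-- The first derivative of the logarithm of `(t + u) / (1 - u t)` along `t' = r (1 - t²)`,
`u' = q (1 - u²)`. -/
theorem hasDerivAt_log_add_sub_log {t u : ℝ → ℝ} {r q : ℝ}
    (ht : HasDerivAt t (r * (1 - t η ^ 2)) η) (hu : HasDerivAt u (q * (1 - u η ^ 2)) η)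
    (hs : t η + u η ≠ 0) (hd : 1 - u η * t η ≠ 0) :
    HasDerivAt (fun x => Real.log (t x + u x) - Real.log (1 - u x * t x))
      (r * ((1 - t η ^ 2) * (1 + u η ^ 2) / ((t η + u η) * (1 - u η * t η)))
        + q * ((1 + t η ^ 2) * (1 - u η ^ 2) / ((t η + u η) * (1 - u η * t η)))) η := by
  refine (((ht.add hu).log hs).sub (((hu.mul ht).const_sub 1).log hd)).congr_deriv ?_
  have hd' : 1 - t η * u η ≠ 0 := by rwa [mul_comm]
  simp only [Pi.add_apply, Pi.mul_apply]
  field_simp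
  ring

/-- For t = tanh x, u = tanh y, the function ln((t + u)/(1 − ut)) is ln(sinh(x + y)/cosh(x − y)),
with second derivative −(r + q)²/sinh²(x + y) − (r − q)²/cosh²(x − y). The stated form follows from
(r + q)² = (r − q)² + 4rq and (t + u)² + (1 − ut)² = (1 + t²)(1 + u²). -/
theorem hasDerivAt_logDeriv_branch {t u : ℝ → ℝ} {r q : ℝ}
    (ht : HasDerivAt t (r * (1 - t η ^ 2)) η) (hu : HasDerivAt u (q * (1 - u η ^ 2)) η)
    (hs : t η + u η ≠ 0) (hd : 1 - u η * t η ≠ 0) :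
    HasDerivAt (fun x => r * ((1 - t x ^ 2) * (1 + u x ^ 2) / ((t x + u x) * (1 - u x * t x)))
        + q * ((1 + t x ^ 2) * (1 - u x ^ 2) / ((t x + u x) * (1 - u x * t x))))
      (-((r - q) ^ 2 *
            ((1 - t η ^ 4) * (1 - u η ^ 4) / ((t η + u η) ^ 2 * (1 - u η * t η) ^ 2))
          + 4 * r * q * ((1 - t η ^ 2) * (1 - u η ^ 2) / (t η + u η) ^ 2))) η := by
  have hden := (ht.add hu).mul ((hu.mul ht).const_sub 1)
  have hden0 : (t η + u η) * (1 - u η * t η) ≠ 0 := mul_ne_zero hs hd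
  have h1 := ((((ht.pow 2).const_sub 1).mul ((hu.pow 2).const_add 1)).div hden hden0).const_mul r
  have h2 := ((((ht.pow 2).const_add 1).mul ((hu.pow 2).const_sub 1)).div hden hden0).const_mul q
  refine (h1.add h2).congr_deriv ?_
  have hd' : 1 - t η * u η ≠ 0 := by rwa [mul_comm]
  simp only [Pi.add_apply, Pi.mul_apply, Pi.pow_apply]
  field_simp
  ring

end Amplitudes

/-! ### Derivatives of the logarithmic ratio of the branches -/

section LogRatio

variable {Λ : Lattice} {J : Couplings} {η : ℝ}

variable (Λ J) in
/-- The logarithm of the ratio of the two branches of the zero mode. -/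
noncomputable def logRatio (η : ℝ) : ℝ :=
  Real.log (coldBranch Λ J η) - Real.log (hotBranch Λ J η)

theorem contDiffOn_log_hotBranch (hJ : J.Ferromagnetic Λ) :
    ContDiffOn ℝ 2 (fun η => Real.log (hotBranch Λ J η)) (Ioi 0) :=
  contDiff_hotBranch.contDiffOn.log fun _ hx => (hotBranch_pos hJ hx).ne'

theorem contDiffOn_log_coldBranch (hJ : J.Ferromagnetic Λ) :
    ContDiffOn ℝ 2 (fun η => Real.log (coldBranch Λ J η)) (Ioi 0) :=
  contDiff_coldBranch.contDiffOn.log fun _ hx => (coldBranch_pos hJ hx).ne'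

theorem contDiffOn_logRatio (hJ : J.Ferromagnetic Λ) : ContDiffOn ℝ 2 (logRatio Λ J) (Ioi 0) :=
  (contDiffOn_log_coldBranch hJ).sub (contDiffOn_log_hotBranch hJ)

/-- `log ((1 + t) / (1 - t))` is linear along `t' = r (1 - t²)`. -/
theorem hasDerivAt_log_one_add_sub_log {t : ℝ → ℝ} {r : ℝ}
    (ht : HasDerivAt t (r * (1 - t η ^ 2)) η) (h1 : 1 + t η ≠ 0) (h2 : 1 - t η ≠ 0) :
    HasDerivAt (fun x => Real.log (1 + t x) - Real.log (1 - t x)) (2 * r) η := by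
  refine (((ht.const_add 1).log h1).sub ((ht.const_sub 1).log h2)).congr_deriv ?_
  field_simp
  ring

/-- The factorizations split ln(c/h) into (t₃ + t₂)/(1 − t₂t₃) and (1 + t₁)/(1 − t₁) = e^{2η₁}, the
source of the constant 2 in a_ε; on the hexagonal lattice into (t₃ + t₁)/(1 − t₁t₃) and t₂. -/
theorem hasDerivAt_logRatio (hJ : J.Ferromagnetic Λ) (hη : 0 < η) :
    HasDerivAt (logRatio Λ J) (aε Λ J η) η := by
  have hJ1 : J.J₁ / J.J₁ = 1 := div_self (J₁_pos hJ).ne'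
  have hJ2 : J.J₂ / J.J₂ = 1 := div_self (J₂_pos hJ).ne'
  have facts : ∀ x, 0 < x → t₂ Λ J x ≠ 0 ∧ 1 + t₁ Λ J x ≠ 0 ∧ 1 - t₁ Λ J x ≠ 0 ∧
      t₃ Λ J x + t₂ Λ J x ≠ 0 ∧ 1 - t₂ Λ J x * t₃ Λ J x ≠ 0 ∧
      t₃ Λ J x + t₁ Λ J x ≠ 0 ∧ 1 - t₁ Λ J x * t₃ Λ J x ≠ 0 := fun x hx =>
    ⟨(t₂_pos hJ hx).ne', by linarith [t₁_pos hJ hx], (sub_pos.2 t₁_lt_one).ne',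
      by linarith [t₂_pos hJ hx, t₃_nonneg hJ hx],
      (one_sub_mul_pos (t₃_nonneg hJ hx) t₂_lt_one t₃_lt_one).ne',
      by linarith [t₁_pos hJ hx, t₃_nonneg hJ hx],
      (one_sub_mul_pos (t₃_nonneg hJ hx) t₁_lt_one t₃_lt_one).ne'⟩
  obtain ⟨f2, f1, f1', f23, f23', f13, f13'⟩ := facts η hη
  cases Λ
  · refine (((hasDerivAt_log_one_add_sub_log hasDerivAt_t₁ f1 f1').add
      (hasDerivAt_log_add_sub_log hasDerivAt_t₃ hasDerivAt_t₂ f23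
        f23')).congr_of_eventuallyEq ?_).congr_deriv ?_
    · filter_upwards [Ioi_mem_nhds hη] with x hx
      obtain ⟨g2, g1, g1', g23, g23', -⟩ := facts x hx
      rw [logRatio, hotBranch_triangular, coldBranch_triangular, add_comm (t₂ _ J x),
        Real.log_mul g1 g23, Real.log_mul g1' g23']
      simp only [Pi.add_apply]
      ring
    · simp only [aε, Jref, hJ1]; ring
  · refine (((hasDerivAt_log_one_add_sub_log hasDerivAt_t₁ f1 f1').add
      (hasDerivAt_log_add_sub_log hasDerivAt_t₃ hasDerivAt_t₂ f23
        f23')).congr_of_eventuallyEq ?_).congr_deriv ?_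
    · filter_upwards [Ioi_mem_nhds hη] with x hx
      obtain ⟨g2, g1, g1', g23, g23', -⟩ := facts x hx
      rw [logRatio, hotBranch_square, coldBranch_square, add_comm (t₂ _ J x),
        Real.log_mul g1 g23, Real.log_mul g1' g23']
      simp only [Pi.add_apply]
      ring
    · simp only [aε, Jref, hJ1]; ring
  · refine (((hasDerivAt_t₂.log f2).add
      (hasDerivAt_log_add_sub_log hasDerivAt_t₃ hasDerivAt_t₁ f13
        f13')).congr_of_eventuallyEq ?_).congr_deriv ?_
    · filter_upwards [Ioi_mem_nhds hη] with x hx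
      obtain ⟨g2, -, -, -, -, g13, -⟩ := facts x hx
      rw [logRatio, hotBranch_hexagonal, coldBranch_hexagonal, Real.log_mul g2 g13,
        mul_comm (t₃ _ J x)]
      simp only [Pi.add_apply]
      ring
    · simp only [aε, Jref, hJ2]; ring

theorem hasDerivAt_aε (hJ : J.Ferromagnetic Λ) (hη : 0 < η) :
    HasDerivAt (aε Λ J) (-(ac Λ J η / η ^ 2)) η := by
  have hJ2 : J.J₂ / J.J₂ = 1 := div_self (J₂_pos hJ).ne'
  have hη' := hη.ne'
  have f2 := (t₂_pos hJ hη).ne'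
  have f23 : t₃ Λ J η + t₂ Λ J η ≠ 0 := by linarith [t₂_pos hJ hη, t₃_nonneg hJ hη]
  have f23' :=
    (one_sub_mul_pos (t₃_nonneg hJ hη) (t₂_lt_one (Λ := Λ) (J := J) (η := η)) t₃_lt_one).ne'
  have f13 : t₃ Λ J η + t₁ Λ J η ≠ 0 := by linarith [t₁_pos hJ hη, t₃_nonneg hJ hη]
  have f13' :=
    (one_sub_mul_pos (t₃_nonneg hJ hη) (t₁_lt_one (Λ := Λ) (J := J) (η := η)) t₃_lt_one).ne'
  cases Λ
  · refine (((hasDerivAt_logDeriv_branch hasDerivAt_t₃ hasDerivAt_t₂ f23 f23').const_add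
      2).congr_deriv ?_).congr_of_eventuallyEq ?_
    · simp only [ac]
      rw [mul_div_cancel_left₀ _ (pow_ne_zero 2 hη')]; rfl
    · filter_upwards with x
      simp only [aε, Jref]; ring
  · refine (((hasDerivAt_logDeriv_branch hasDerivAt_t₃ hasDerivAt_t₂ f23 f23').const_add
      2).congr_deriv ?_).congr_of_eventuallyEq ?_
    · simp only [ac]
      rw [mul_div_cancel_left₀ _ (pow_ne_zero 2 hη')]; rfl
    · filter_upwards with x
      simp only [aε, Jref]; ring
  · have ht := hasDerivAt_t₂ (Λ := .hexagonal) (J := J) (η := η)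
    refine (((hasDerivAt_logDeriv_branch hasDerivAt_t₃ hasDerivAt_t₁ f13 f13').add
      (((ht.pow 2).const_sub 1).div ht f2)).congr_deriv ?_).congr_of_eventuallyEq ?_
    · rw [ac, mul_div_cancel_left₀ _ (pow_ne_zero 2 hη')]
      simp only [Jref, hJ2, Pi.pow_apply]
      rw [neg_add (_ + _) (_ / t₂ _ J η ^ 2), add_right_inj]
      field_simp
      ring
    · filter_upwards with x
      simp only [aε, Jref, Pi.add_apply, Pi.div_apply, Pi.pow_apply]; ring

theorem deriv_logRatio (hJ : J.Ferromagnetic Λ) :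
    EqOn (deriv (logRatio Λ J)) (aε Λ J) (Ioi 0) := fun _ hx => (hasDerivAt_logRatio hJ hx).deriv

theorem continuousAt_deriv_aε (hJ : J.Ferromagnetic Λ) (hη : 0 < η) :
    ContinuousAt (deriv (aε Λ J)) η :=
  (continuousAt_deriv_deriv_of_contDiffOn (contDiffOn_logRatio hJ) hη).congr
    ((eqOn_deriv_of_isOpen isOpen_Ioi (deriv_logRatio hJ)).eventuallyEq_of_mem
      (Ioi_mem_nhds hη))

end LogRatio

/-! ### Closed form and smoothness of the modes -/

section Modes

variable {Λ : Lattice} {J : Couplings} {η : ℝ} {L : ℕ}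

/-- A₁, A₂ and A₃ each factor into tᵢ and 1 − tⱼ². Strict positivity of A₁ is what separates the
nonzero modes from criticality; A₃ vanishes on the square lattice. -/
theorem A₁_pos (hJ : J.Ferromagnetic Λ) (hη : 0 < η) : 0 < A₁ Λ J η := by
  have h1 := t₁_pos hJ hη
  have l2 : 0 < 1 - t₂ Λ J η ^ 2 := sub_pos.2 (Real.tanh_sq_lt_one _)
  have l3 : 0 < 1 - t₃ Λ J η ^ 2 := sub_pos.2 (Real.tanh_sq_lt_one _)
  cases Λ
  · calc 0 < 2 * (t₁ .triangular J η * (1 - t₂ .triangular J η ^ 2)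
        * (1 - t₃ .triangular J η ^ 2)) := by positivity
      _ = _ := by simp only [A₁, α₀, α₁, α₂, α₃]; ring
  · calc 0 < 2 * (t₁ .square J η * (1 - t₂ .square J η ^ 2)
        * (1 - t₃ .square J η ^ 2)) := by positivity
      _ = _ := by simp only [A₁, α₀, α₁, α₂, α₃]; ring
  · have h3 := t₃_pos hJ hη
    calc 0 < 2 * (t₁ .hexagonal J η * t₃ .hexagonal J η
        * (1 - t₂ .hexagonal J η ^ 2)) := by positivity
      _ = _ := by simp only [A₁, α₀, α₁, α₂, α₃]; ring

theorem A₂_pos (hJ : J.Ferromagnetic Λ) (hη : 0 < η) : 0 < A₂ Λ J η := by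
  have h2 := t₂_pos hJ hη
  have l1 : 0 < 1 - t₁ Λ J η ^ 2 := sub_pos.2 (Real.tanh_sq_lt_one _)
  have l3 : 0 < 1 - t₃ Λ J η ^ 2 := sub_pos.2 (Real.tanh_sq_lt_one _)
  cases Λ
  · calc 0 < 2 * (t₂ .triangular J η * (1 - t₁ .triangular J η ^ 2)
        * (1 - t₃ .triangular J η ^ 2)) := by positivity
      _ = _ := by simp only [A₂, α₀, α₁, α₂, α₃]; ring
  · calc 0 < 2 * (t₂ .square J η * (1 - t₁ .square J η ^ 2)
        * (1 - t₃ .square J η ^ 2)) := by positivity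
      _ = _ := by simp only [A₂, α₀, α₁, α₂, α₃]; ring
  · have h3 := t₃_pos hJ hη
    calc 0 < 2 * (t₂ .hexagonal J η * t₃ .hexagonal J η
        * (1 - t₁ .hexagonal J η ^ 2)) := by positivity
      _ = _ := by simp only [A₂, α₀, α₁, α₂, α₃]; ring

theorem A₃_nonneg (hJ : J.Ferromagnetic Λ) (hη : 0 < η) : 0 ≤ A₃ Λ J η := by
  have h1 := t₁_pos hJ hη
  have h2 := t₂_pos hJ hη
  have h3 := t₃_nonneg hJ hη
  have l1 : 0 < 1 - t₁ Λ J η ^ 2 := sub_pos.2 (Real.tanh_sq_lt_one _)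
  have l2 : 0 < 1 - t₂ Λ J η ^ 2 := sub_pos.2 (Real.tanh_sq_lt_one _)
  have l3 : 0 < 1 - t₃ Λ J η ^ 2 := sub_pos.2 (Real.tanh_sq_lt_one _)
  cases Λ
  · calc 0 ≤ 2 * (t₃ .triangular J η * (1 - t₁ .triangular J η ^ 2)
        * (1 - t₂ .triangular J η ^ 2)) := by positivity
      _ = _ := by simp only [A₃, α₀, α₁, α₂, α₃]; ring
  · calc 0 ≤ 2 * (t₃ .square J η * (1 - t₁ .square J η ^ 2)
        * (1 - t₂ .square J η ^ 2)) := by positivity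
      _ = _ := by simp only [A₃, α₀, α₁, α₂, α₃]; ring
  · calc 0 ≤ 2 * (t₁ .hexagonal J η * t₂ .hexagonal J η
        * (1 - t₃ .hexagonal J η ^ 2)) := by positivity
      _ = _ := by simp only [A₃, α₀, α₁, α₂, α₃]; ring

theorem contDiff_A₀ : ContDiff ℝ 2 (A₀ Λ J) :=
  (((contDiff_α₀.pow 2).add (contDiff_α₁.pow 2)).add (contDiff_α₂.pow 2)).add (contDiff_α₃.pow 2)

theorem contDiff_A₁ : ContDiff ℝ 2 (A₁ Λ J) :=
  contDiff_const.mul ((contDiff_α₀.mul contDiff_α₁).sub (contDiff_α₂.mul contDiff_α₃))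

theorem contDiff_A₂ : ContDiff ℝ 2 (A₂ Λ J) :=
  contDiff_const.mul ((contDiff_α₀.mul contDiff_α₂).sub (contDiff_α₃.mul contDiff_α₁))

theorem contDiff_A₃ : ContDiff ℝ 2 (A₃ Λ J) :=
  contDiff_const.mul ((contDiff_α₀.mul contDiff_α₃).sub (contDiff_α₁.mul contDiff_α₂))

variable (Λ J L) in
/-- The discriminant of the mode `p`. -/
noncomputable def modeDisc (p η : ℝ) : ℝ :=
  (A₀ Λ J η - A₁ Λ J η * Real.cos (2 * Real.pi * p / L)) ^ 2 -
    (A₂ Λ J η ^ 2 + A₃ Λ J η ^ 2 + 2 * A₂ Λ J η * A₃ Λ J η * Real.cos (2 * Real.pi * p / L))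

theorem A₂_add_A₃_le : A₂ Λ J η + A₃ Λ J η ≤ A₀ Λ J η - A₁ Λ J η := by
  rw [A₀_sub_A₁, A₂_add_A₃]
  nlinarith [sq_nonneg (hotBranch Λ J η - coldBranch Λ J η)]

theorem mode_mean_pos (hJ : J.Ferromagnetic Λ) (hη : 0 < η) (p : ℝ) :
    0 < A₀ Λ J η - A₁ Λ J η * Real.cos (2 * Real.pi * p / L) := by
  have hc := Real.cos_le_one (2 * Real.pi * p / L)
  have := mul_le_of_le_one_right (A₁_pos hJ hη).le hc
  linarith [A₂_pos hJ hη, A₃_nonneg hJ hη, A₂_add_A₃_le (Λ := Λ) (J := J) (η := η)]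

theorem modeDisc_nonneg (hJ : J.Ferromagnetic Λ) (hη : 0 < η) (p : ℝ) :
    0 ≤ modeDisc Λ J L p η := by
  have hc := Real.cos_le_one (2 * Real.pi * p / L)
  have h1 := mul_le_of_le_one_right (A₁_pos hJ hη).le hc
  have h2 := mul_le_of_le_one_right
    (mul_nonneg (mul_nonneg zero_le_two (A₂_pos hJ hη).le) (A₃_nonneg hJ hη)) hc
  have h3 : A₂ Λ J η + A₃ Λ J η ≤ A₀ Λ J η - A₁ Λ J η * Real.cos (2 * Real.pi * p / L) := by
    linarith [A₂_add_A₃_le (Λ := Λ) (J := J) (η := η)]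
  have h4 := pow_le_pow_left₀ (add_nonneg (A₂_pos hJ hη).le (A₃_nonneg hJ hη)) h3 2
  unfold modeDisc
  linarith

/-- Lowering the cosine below 1 strictly raises the mean A₀ − A₁ cos θ and does not raise the
subtracted term above (A₂ + A₃)². Hence the square root is smooth even at η_c. -/
theorem modeDisc_pos (hJ : J.Ferromagnetic Λ) (hη : 0 < η) {p : ℝ}
    (hp : Real.cos (2 * Real.pi * p / L) ≠ 1) : 0 < modeDisc Λ J L p η := by
  have hc := (Real.cos_le_one (2 * Real.pi * p / L)).lt_of_ne hp
  have h1 := mul_lt_of_lt_one_right (A₁_pos hJ hη) hc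
  have h2 := mul_le_of_le_one_right
    (mul_nonneg (mul_nonneg zero_le_two (A₂_pos hJ hη).le) (A₃_nonneg hJ hη)) hc.le
  have h3 : A₂ Λ J η + A₃ Λ J η < A₀ Λ J η - A₁ Λ J η * Real.cos (2 * Real.pi * p / L) := by
    linarith [A₂_add_A₃_le (Λ := Λ) (J := J) (η := η)]
  have h4 := pow_lt_pow_left₀ h3 (add_nonneg (A₂_pos hJ hη).le (A₃_nonneg hJ hη)) two_ne_zero
  unfold modeDisc
  linarith

theorem modeFreeEnergy_eq (hJ : J.Ferromagnetic Λ) (hη : 0 < η) (p : ℝ) :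
    modeFreeEnergy Λ J L p η = -(1 / (2 * cellSites Λ * L)) *
      Real.log ((A₀ Λ J η - A₁ Λ J η * Real.cos (2 * Real.pi * p / L)
        + √(modeDisc Λ J L p η)) / 2) := by
  have hdisc := modeDisc_nonneg (L := L) hJ hη p
  set θ := 2 * Real.pi * p / L with hθ
  -- Expanding cos(θ − φ) gives the coefficients of cos φ and sin φ to which the circle average
  -- applies.
  have hxy : (A₂ Λ J η + A₃ Λ J η * Real.cos θ) ^ 2 + (A₃ Λ J η * Real.sin θ) ^ 2 =
      A₂ Λ J η ^ 2 + A₃ Λ J η ^ 2 + 2 * A₂ Λ J η * A₃ Λ J η * Real.cos θ := by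
    linear_combination A₃ Λ J η ^ 2 * Real.sin_sq_add_cos_sq θ
  rw [modeFreeEnergy, modeDisc, ← hθ, ← hxy, ← integral_log_sub_cos_sub_sin
    (mode_mean_pos hJ hη p) (by rw [modeDisc, ← hθ] at hdisc; linarith)]
  congr 2
  refine intervalIntegral.integral_congr fun φ _ => ?_
  rw [Real.cos_sub]
  congr 1
  ring

theorem contDiffOn_modeFreeEnergy (hJ : J.Ferromagnetic Λ) {p : ℝ}
    (hp : Real.cos (2 * Real.pi * p / L) ≠ 1) :
    ContDiffOn ℝ 2 (modeFreeEnergy Λ J L p) (Ioi 0) := by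
  have hmean : ContDiff ℝ 2
      (fun η => A₀ Λ J η - A₁ Λ J η * Real.cos (2 * Real.pi * p / L)) :=
    contDiff_A₀.sub (contDiff_A₁.mul contDiff_const)
  have hdisc : ContDiff ℝ 2 (modeDisc Λ J L p) :=
    (hmean.pow 2).sub (((contDiff_A₂.pow 2).add (contDiff_A₃.pow 2)).add
      (((contDiff_const.mul contDiff_A₂).mul contDiff_A₃).mul contDiff_const))
  refine ContDiffOn.congr ?_ fun η hη => modeFreeEnergy_eq hJ hη p
  refine contDiffOn_const.mul (ContDiffOn.log ?_ fun η hη => ?_)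
  · exact (hmean.contDiffOn.add
      (hdisc.contDiffOn.sqrt fun η hη => (modeDisc_pos hJ hη hp).ne')).div_const 2
  · have := mode_mean_pos (L := L) hJ hη p
    have := Real.sqrt_nonneg (modeDisc Λ J L p η)
    linarith

/-- Its square root is |h² − c²|, the only source of nonsmoothness: (h² + c² + |h² − c²|)/2 = max(h,
c)². -/
theorem modeDisc_zero : modeDisc Λ J L 0 η =
    (hotBranch Λ J η ^ 2 - coldBranch Λ J η ^ 2) ^ 2 := by
  have h : modeDisc Λ J L 0 η =
      (A₀ Λ J η - A₁ Λ J η) ^ 2 - (A₂ Λ J η + A₃ Λ J η) ^ 2 := by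
    simp only [modeDisc, mul_zero, zero_div, Real.cos_zero]; ring
  rw [h, A₀_sub_A₁, A₂_add_A₃]; ring

theorem modeFreeEnergy_zero_of_le (hJ : J.Ferromagnetic Λ) (hη : 0 < η)
    (h : coldBranch Λ J η ≤ hotBranch Λ J η) :
    modeFreeEnergy Λ J L 0 η = -(1 / (cellSites Λ * L)) * Real.log (hotBranch Λ J η) := by
  have hsq := pow_le_pow_left₀ (coldBranch_pos hJ hη).le h 2
  rw [modeFreeEnergy_eq hJ hη, modeDisc_zero, Real.sqrt_sq (sub_nonneg.2 hsq), mul_zero, zero_div,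
    Real.cos_zero, mul_one, A₀_sub_A₁, show (hotBranch Λ J η ^ 2 + coldBranch Λ J η ^ 2
      + (hotBranch Λ J η ^ 2 - coldBranch Λ J η ^ 2)) / 2 = hotBranch Λ J η ^ 2 by ring,
    Real.log_pow, mul_assoc 2, one_div, mul_inv, Nat.cast_ofNat]
  ring

theorem modeFreeEnergy_zero_of_ge (hJ : J.Ferromagnetic Λ) (hη : 0 < η)
    (h : hotBranch Λ J η ≤ coldBranch Λ J η) :
    modeFreeEnergy Λ J L 0 η = -(1 / (cellSites Λ * L)) * Real.log (coldBranch Λ J η) := by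
  have hsq := pow_le_pow_left₀ (hotBranch_pos hJ hη).le h 2
  rw [modeFreeEnergy_eq hJ hη, modeDisc_zero,
    ← neg_sub (coldBranch Λ J η ^ 2), neg_sq, Real.sqrt_sq (sub_nonneg.2 hsq),
    mul_zero, zero_div, Real.cos_zero, mul_one, A₀_sub_A₁,
    show (hotBranch Λ J η ^ 2 + coldBranch Λ J η ^ 2
      + (coldBranch Λ J η ^ 2 - hotBranch Λ J η ^ 2)) / 2 = coldBranch Λ J η ^ 2 by ring,
    Real.log_pow, mul_assoc 2, one_div, mul_inv, Nat.cast_ofNat]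
  ring

theorem cos_ne_one_of_ne_int_mul {p : ℝ} (hL : 0 < L) (h : ∀ k : ℤ, p ≠ k * L) :
    Real.cos (2 * Real.pi * p / L) ≠ 1 := by
  rw [Ne, Real.cos_eq_one_iff]
  rintro ⟨k, hk⟩
  have hL' : (L : ℝ) ≠ 0 := by exact_mod_cast hL.ne'
  have hpi := Real.pi_ne_zero
  refine h k ?_
  field_simp at hk
  linarith

theorem contDiffOn_modeFreeEnergy_nat (hJ : J.Ferromagnetic Λ) {k : ℕ} (hk : 0 < k)
    (hkL : k < L) : ContDiffOn ℝ 2 (modeFreeEnergy Λ J L k) (Ioi 0) := by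
  refine contDiffOn_modeFreeEnergy hJ (cos_ne_one_of_ne_int_mul (hk.trans hkL) fun j hj => ?_)
  have hj' : (k : ℤ) = j * L := by exact_mod_cast hj
  have hdvd : L ∣ k := Int.natCast_dvd_natCast.1 ⟨j, by rw [hj', mul_comm]⟩
  exact absurd (Nat.le_of_dvd hk hdvd) (not_le.2 hkL)

theorem contDiffOn_modeFreeEnergy_half (hJ : J.Ferromagnetic Λ) (hL : 0 < L) (k : ℕ) :
    ContDiffOn ℝ 2 (modeFreeEnergy Λ J L (k + 1 / 2)) (Ioi 0) := by
  refine contDiffOn_modeFreeEnergy hJ (cos_ne_one_of_ne_int_mul hL fun j hj => ?_)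
  -- Parity excludes half-integer momenta from the multiples of L.
  have hj' : 2 * (k : ℤ) + 1 = 2 * (j * L) := by
    have : 2 * (k : ℝ) + 1 = 2 * (j * L) := by linarith
    exact_mod_cast this
  omega

theorem contDiffOn_log_R : ContDiffOn ℝ 2 (fun η => -Real.log (R Λ J η)) (Ioi 0) := by
  have h : ∀ r : ℝ, ContDiff ℝ 2 (fun η => Real.cosh (r * η)) := fun r =>
    Real.contDiff_cosh.comp (contDiff_const.mul contDiff_id)
  have hprod : ContDiff ℝ 2 (fun η => Real.cosh (η₁ Λ J η) * Real.cosh (η₂ Λ J η)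
      * Real.cosh (η₃ Λ J η)) := ((h _).mul (h _)).mul (h _)
  have hpos : ∀ η, 0 < Real.cosh (η₁ Λ J η) * Real.cosh (η₂ Λ J η) * Real.cosh (η₃ Λ J η) :=
    fun η => mul_pos (mul_pos (Real.cosh_pos _) (Real.cosh_pos _)) (Real.cosh_pos _)
  refine ContDiff.contDiffOn (ContDiff.neg (ContDiff.log ?_ fun η => ?_))
  · cases Λ
    · exact contDiff_const.mul hprod
    · exact contDiff_const.mul hprod
    · exact contDiff_const.mul (hprod.sqrt fun η => (hpos η).ne')
  · cases Λ
    · exact (mul_pos two_pos (hpos η)).ne'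
    · exact (mul_pos two_pos (hpos η)).ne'
    · exact (mul_pos two_pos (Real.sqrt_pos.2 (hpos η))).ne'

theorem contDiffOn_freeEnergy_periodic (hJ : J.Ferromagnetic Λ) (hL : 0 < L) :
    ContDiffOn ℝ 2 (freeEnergy Λ J L .periodic) (Ioi 0) :=
  contDiffOn_log_R.add (ContDiffOn.sum fun k _ => contDiffOn_modeFreeEnergy_half hJ hL k)

end Modes

/-! ### The jumps at the critical point and their expression through G -/

section Gaps

variable {Λ : Lattice} {J : Couplings} {η ηc : ℝ} {L : ℕ}

variable (Λ J L) in
/-- The free energy of the antiperiodic cylinder without its zero mode. -/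
noncomputable def regularPart (η : ℝ) : ℝ :=
  -Real.log (R Λ J η) + ∑ k ∈ Finset.Ico 1 L, modeFreeEnergy Λ J L k η

theorem contDiffOn_regularPart (hJ : J.Ferromagnetic Λ) :
    ContDiffOn ℝ 2 (regularPart Λ J L) (Ioi 0) :=
  contDiffOn_log_R.add (ContDiffOn.sum fun _ hk =>
    contDiffOn_modeFreeEnergy_nat hJ (Finset.mem_Ico.1 hk).1 (Finset.mem_Ico.1 hk).2)

theorem freeEnergy_antiperiodic (hL : 0 < L) :
    freeEnergy Λ J L .antiperiodic η = regularPart Λ J L η + modeFreeEnergy Λ J L 0 η := by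
  simp only [freeEnergy, regularPart, Joining.shift, add_zero]
  rw [Finset.range_eq_Ico, Finset.sum_eq_sum_Ico_succ_bot hL, Nat.cast_zero]
  ring

theorem isGluing_freeEnergy (hJ : J.Ferromagnetic Λ) (hL : 0 < L) (hc : IsCritical Λ J ηc) :
    IsGluing (freeEnergy Λ J L .antiperiodic)
      (fun η => regularPart Λ J L η
        + -(1 / (cellSites Λ * L)) * Real.log (hotBranch Λ J η))
      (fun η => regularPart Λ J L η
        + -(1 / (cellSites Λ * L)) * Real.log (coldBranch Λ J η)) ηc where
  pos := hc.1
  left := (contDiffOn_regularPart hJ).add (contDiffOn_const.mul (contDiffOn_log_hotBranch hJ))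
  right := (contDiffOn_regularPart hJ).add (contDiffOn_const.mul (contDiffOn_log_coldBranch hJ))
  eqOn_left := fun η hη => by
    rw [freeEnergy_antiperiodic hL, modeFreeEnergy_zero_of_le hJ hη.1]
    rcases hη.2.lt_or_eq with h | rfl
    · exact (coldBranch_lt_hotBranch hJ hc hη.1 h).le
    · exact (isCritical_iff.1 hc).2.ge
  eqOn_right := fun η hη => by
    rw [freeEnergy_antiperiodic hL, modeFreeEnergy_zero_of_ge hJ (hc.1.trans_le hη)]
    rcases (mem_Ici.1 hη).lt_or_eq with h | rfl
    · exact (hotBranch_lt_coldBranch hJ hc h).le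
    · exact (isCritical_iff.1 hc).2.le

/-- The common regular part cancels, so both jumps are derivatives of k ln(c/h); no differentiation
of the other modes is needed. -/
theorem IsGluing.deriv_sub {f U V : ℝ → ℝ} {k : ℝ} (hJ : J.Ferromagnetic Λ)
    (h : IsGluing f U V ηc) (hUV : ∀ η, U η = V η + k * logRatio Λ J η) :
    deriv U ηc - deriv V ηc = k * aε Λ J ηc ∧
      -ηc ^ 2 * deriv (deriv U) ηc - -ηc ^ 2 * deriv (deriv V) ηc = k * ac Λ J ηc := by
  have h1 : EqOn (deriv U) (fun η => deriv V η + k * aε Λ J η) (Ioi 0) := fun η hη => by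
    rw [funext hUV]
    exact ((differentiableAt_of_contDiffOn h.right hη).hasDerivAt.add
      ((hasDerivAt_logRatio hJ hη).const_mul k)).deriv
  have h2 : deriv (deriv U) ηc = deriv (deriv V) ηc + k * -(ac Λ J ηc / ηc ^ 2) := by
    rw [eqOn_deriv_of_isOpen isOpen_Ioi h1 h.pos]
    exact ((differentiableAt_deriv_of_contDiffOn h.right h.pos).hasDerivAt.add
      ((hasDerivAt_aε hJ h.pos).const_mul k)).deriv
  have hc := h.pos.ne'
  constructor
  · rw [h1 h.pos]; ring
  · rw [h2]; field_simp; ring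

theorem G_zero (hJ : J.Ferromagnetic Λ) (hη : 0 < η) : G Λ J L 0 η =
    2 * hotBranch Λ J η * coldBranch Λ J η / (hotBranch Λ J η ^ 2 + coldBranch Λ J η ^ 2) := by
  have hP := hotBranch_pos hJ hη
  have hS := coldBranch_pos hJ hη
  simp only [G, mul_zero, zero_div, Real.cos_zero, mul_one]
  rw [A₀_sub_A₁, show A₂ Λ J η ^ 2 + A₃ Λ J η ^ 2 + 2 * A₂ Λ J η * A₃ Λ J η =
    (A₂ Λ J η + A₃ Λ J η) ^ 2 by ring, A₂_add_A₃, Real.sqrt_sq (by positivity)]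

/-- The logarithmic derivative of 2hc/(h² + c²) is (h² − c²)/(h² + c²) times that of c/h, while √(1
− G²) = |h² − c²|/(h² + c²); only a sign survives. At η_c both sides are 0 because division by zero
gives 0. -/
theorem Dε_zero (hJ : J.Ferromagnetic Λ) (hη : 0 < η) : Dε Λ J L 0 η =
    (hotBranch Λ J η ^ 2 - coldBranch Λ J η ^ 2)
      / |hotBranch Λ J η ^ 2 - coldBranch Λ J η ^ 2| * aε Λ J η := by
  have hP := hotBranch_pos hJ hη
  have hS := coldBranch_pos hJ hη
  have dP := (contDiff_hotBranch (Λ := Λ) (J := J)).differentiable two_ne_zero η |>.hasDerivAt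
  have dS := (contDiff_coldBranch (Λ := Λ) (J := J)).differentiable two_ne_zero η |>.hasDerivAt
  have hK : 0 < hotBranch Λ J η ^ 2 + coldBranch Λ J η ^ 2 := by positivity
  have haε : aε Λ J η = deriv (coldBranch Λ J) η / coldBranch Λ J η
      - deriv (hotBranch Λ J) η / hotBranch Λ J η :=
    (hasDerivAt_logRatio hJ hη).unique ((dS.log hS.ne').sub (dP.log hP.ne'))
  have hlog : (fun x => Real.log (G Λ J L 0 x)) =ᶠ[𝓝 η] fun x =>
      Real.log (2 * hotBranch Λ J x * coldBranch Λ J x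
        / (hotBranch Λ J x ^ 2 + coldBranch Λ J x ^ 2)) := by
    filter_upwards [Ioi_mem_nhds hη] with x hx
    rw [G_zero hJ hx]
  have hder := (((dP.const_mul 2).mul dS).div ((dP.pow 2).add (dS.pow 2)) hK.ne').log
    (by simp only [Pi.div_apply, Pi.mul_apply, Pi.add_apply, Pi.pow_apply]; positivity)
  have hsqrt : √(1 - G Λ J L 0 η ^ 2) = |hotBranch Λ J η ^ 2 - coldBranch Λ J η ^ 2|
      / (hotBranch Λ J η ^ 2 + coldBranch Λ J η ^ 2) := by
    rw [G_zero hJ hη, ← Real.sqrt_sq_eq_abs, ← Real.sqrt_sq hK.le, ← Real.sqrt_div (sq_nonneg _),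
      Real.sqrt_sq hK.le]
    congr 1
    field_simp
    ring
  rw [Dε, hsqrt, (hder.congr_of_eventuallyEq hlog).deriv, haε, one_div_div]
  simp only [Pi.div_apply, Pi.mul_apply, Pi.add_apply, Pi.pow_apply]
  rw [div_mul_eq_mul_div, div_mul_eq_mul_div]
  congr 1
  field_simp
  ring

theorem Dε_zero_of_lt (hJ : J.Ferromagnetic Λ) (hc : IsCritical Λ J ηc) :
    EqOn (Dε Λ J L 0) (aε Λ J) (Ioo 0 ηc) := fun η hη => by
  have h := pow_lt_pow_left₀ (coldBranch_lt_hotBranch hJ hc hη.1 hη.2)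
    (coldBranch_pos hJ hη.1).le two_ne_zero
  rw [Dε_zero hJ hη.1, abs_of_pos (sub_pos.2 h), div_self (sub_pos.2 h).ne', one_mul]

theorem Dε_zero_of_gt (hJ : J.Ferromagnetic Λ) (hc : IsCritical Λ J ηc) :
    EqOn (Dε Λ J L 0) (fun η => -aε Λ J η) (Ioi ηc) := fun η hη => by
  have hη0 : 0 < η := hc.1.trans hη
  have h := pow_lt_pow_left₀ (hotBranch_lt_coldBranch hJ hc hη)
    (hotBranch_pos hJ hη0).le two_ne_zero
  rw [Dε_zero hJ hη0, abs_of_neg (sub_neg.2 h), div_neg, div_self (sub_neg.2 h).ne, neg_one_mul]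

/-- The sign flip turns the differences of D_ε and D_c into sums of values of one continuous
function; the resulting 2 cancels the one in 1/(2sL). -/
theorem tendsto_sub_add {g : ℝ → ℝ} {c : ℝ} (hg : ContinuousAt g c) :
    Tendsto (fun x => g (c - x) + g (c + x)) (𝓝[>] 0) (𝓝 (2 * g c)) := by
  have h1 : Tendsto (fun x : ℝ => c - x) (𝓝[>] 0) (𝓝 c) := by
    have : Tendsto (fun x : ℝ => c - x) (𝓝 0) (𝓝 (c - 0)) :=
      (continuous_const.sub continuous_id).tendsto 0
    simpa using this.mono_left nhdsWithin_le_nhds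
  have h2 : Tendsto (fun x : ℝ => c + x) (𝓝[>] 0) (𝓝 c) := by
    have : Tendsto (fun x : ℝ => c + x) (𝓝 0) (𝓝 (c + 0)) :=
      (continuous_const.add continuous_id).tendsto 0
    simpa using this.mono_left nhdsWithin_le_nhds
  rw [two_mul]
  exact (hg.tendsto.comp h1).add (hg.tendsto.comp h2)

theorem tendsto_Dε_gap (hJ : J.Ferromagnetic Λ) (hc : IsCritical Λ J ηc) :
    Tendsto (fun x => Dε Λ J L 0 (ηc - x) - Dε Λ J L 0 (ηc + x)) (𝓝[>] 0)
      (𝓝 (2 * aε Λ J ηc)) := by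
  refine (tendsto_sub_add (hasDerivAt_aε hJ hc.1).continuousAt).congr' ?_
  filter_upwards [Ioo_mem_nhdsGT hc.1] with x hx
  have hm : ηc - x ∈ Ioo 0 ηc := ⟨by linarith [hx.2], by linarith [hx.1]⟩
  have hp : ηc + x ∈ Ioi ηc := by simpa using hx.1
  rw [Dε_zero_of_lt hJ hc hm, Dε_zero_of_gt hJ hc hp, sub_neg_eq_add]

theorem tendsto_Dc_gap (hJ : J.Ferromagnetic Λ) (hc : IsCritical Λ J ηc) :
    Tendsto (fun x => Dc Λ J L 0 (ηc - x) - Dc Λ J L 0 (ηc + x)) (𝓝[>] 0)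
      (𝓝 (2 * (ac Λ J ηc / ηc ^ 2))) := by
  have hlim := (tendsto_sub_add (continuousAt_deriv_aε hJ hc.1)).neg
  rw [(hasDerivAt_aε hJ hc.1).deriv, mul_neg, neg_neg] at hlim
  refine hlim.congr' ?_
  filter_upwards [Ioo_mem_nhdsGT hc.1] with x hx
  have hm : ηc - x ∈ Ioo 0 ηc := ⟨by linarith [hx.2], by linarith [hx.1]⟩
  have hp : ηc + x ∈ Ioi ηc := by simpa using hx.1
  rw [Dc, Dc, eqOn_deriv_of_isOpen isOpen_Ioo (Dε_zero_of_lt hJ hc) hm,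
    eqOn_deriv_of_isOpen isOpen_Ioi (Dε_zero_of_gt hJ hc) hp, deriv.fun_neg]
  ring

end Gaps

end IsingCylinder

/-! ### The main theorem -/

theorem mainTheorem1 (Λ : Lattice) (J : Couplings) (hJ : J.Ferromagnetic Λ)
    (L : ℕ) (hL : 0 < L) (kB : ℝ) (hkB : 0 < kB) :
    -- the bulk critical point exists and is unique
    (∃! ηc : ℝ, IsCritical Λ J ηc) ∧
    ∀ ηc : ℝ, IsCritical Λ J ηc →
      -- antiperiodic joining: the only singularity is a first-order transition at the critical point
      (ContinuousOn (freeEnergy Λ J L .antiperiodic) (Ioi 0) ∧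
        ContDiffOn ℝ 2 (freeEnergy Λ J L .antiperiodic) (Ioi 0 \ {ηc}) ∧
        HasFirstOrderTransition (freeEnergy Λ J L .antiperiodic) ηc) ∧
      -- the critical gaps and their amplitudes
      (HasCriticalGap (fun T => internalEnergy Λ J L .antiperiodic (reduced Λ J kB T))
          (reduced Λ J kB ηc) (aε Λ J ηc / (cellSites Λ * L)) ∧
        HasCriticalGap (fun T => specificHeat Λ J L .antiperiodic (reduced Λ J kB T))
          (reduced Λ J kB ηc) (ac Λ J ηc / (cellSites Λ * L)) ∧
        0 < aε Λ J ηc ∧ 0 < ac Λ J ηc) ∧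
      -- only the zero mode contributes to the gaps
      (ContDiffOn ℝ 2 (fun η => -Real.log (R Λ J η)) (Ioi 0) ∧
        (∀ pbar : ℕ, 0 < pbar → pbar < L →
          ContDiffOn ℝ 2 (modeFreeEnergy Λ J L pbar) (Ioi 0)) ∧
        Tendsto (fun x => 1 / (2 * cellSites Λ * L) *
            (Dε Λ J L 0 (ηc - x) - Dε Λ J L 0 (ηc + x)))
          (𝓝[>] 0) (𝓝 (aε Λ J ηc / (cellSites Λ * L))) ∧
        Tendsto (fun x => ηc ^ 2 / (2 * cellSites Λ * L) *
            (Dc Λ J L 0 (ηc - x) - Dc Λ J L 0 (ηc + x)))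
          (𝓝[>] 0) (𝓝 (ac Λ J ηc / (cellSites Λ * L)))) ∧
      -- periodic joining: no jump
      (ContDiffOn ℝ 2 (freeEnergy Λ J L .periodic) (Ioi 0) ∧
        HasCriticalGap (fun T => internalEnergy Λ J L .periodic (reduced Λ J kB T))
          (reduced Λ J kB ηc) 0 ∧
        HasCriticalGap (fun T => specificHeat Λ J L .periodic (reduced Λ J kB T))
          (reduced Λ J kB ηc) 0 ∧
        ¬ HasFirstOrderTransition (freeEnergy Λ J L .periodic) ηc) := by
  refine ⟨existsUnique_isCritical hJ, fun ηc hc => ?_⟩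
  have hA := Jref_pos hJ
  have hs : 0 < cellSites Λ := by cases Λ <;> norm_num [cellSites]
  have hL' : (0 : ℝ) < L := by exact_mod_cast hL
  have hsL : 0 < cellSites Λ * L := mul_pos hs hL'
  have glue := isGluing_freeEnergy hJ hL hc
  have per := contDiffOn_freeEnergy_periodic (Λ := Λ) hJ hL
  -- Both branches are f itself, so the same one-sided limits apply and the gap is a number minus
  -- itself.
  have gluePer : IsGluing (freeEnergy Λ J L .periodic) _ _ ηc :=
    ⟨hc.1, per, per, fun _ _ => rfl, fun _ _ => rfl⟩
  obtain ⟨gapε, gapc⟩ := glue.deriv_sub (k := 1 / (cellSites Λ * L)) hJ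
    fun η => by simp only [logRatio]; ring
  rw [one_div_mul_eq_div] at gapε gapc
  refine ⟨⟨glue.continuousOn, glue.contDiffOn, glue.continuousAt, _, _,
      glue.hasDerivWithinAt_left, glue.hasDerivWithinAt_right, ?_⟩,
    ⟨?_, ?_, aε_pos hJ hc.1, ac_pos hJ hc.1⟩,
    ⟨contDiffOn_log_R, fun k hk hkL => contDiffOn_modeFreeEnergy_nat hJ hk hkL, ?_, ?_⟩,
    ⟨per, ?_, ?_, not_hasFirstOrderTransition_of_differentiableAt
      (differentiableAt_of_contDiffOn per hc.1)⟩⟩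
  · exact sub_ne_zero.1 (gapε ▸ (div_pos (aε_pos hJ hc.1) hsL).ne')
  · exact gapε ▸ hasCriticalGap_comp_div hA hkB hc.1 glue.tendsto_left.1 glue.tendsto_right.1
  · exact gapc ▸ hasCriticalGap_comp_div hA hkB hc.1 glue.tendsto_left.2 glue.tendsto_right.2
  · have h := (tendsto_Dε_gap (L := L) hJ hc).const_mul (1 / (2 * cellSites Λ * L))
    convert h using 2
    field_simp
  · have h := (tendsto_Dc_gap (L := L) hJ hc).const_mul (ηc ^ 2 / (2 * cellSites Λ * L))
    have := hc.1.ne'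
    convert h using 2
    field_simp
  · exact sub_self (_ : ℝ) ▸ hasCriticalGap_comp_div hA hkB hc.1 gluePer.tendsto_left.1
      gluePer.tendsto_right.1
  · exact sub_self (_ : ℝ) ▸ hasCriticalGap_comp_div hA hkB hc.1 gluePer.tendsto_left.2
      gluePer.tendsto_right.2
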